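/- Let $d\ge 2$ be an integer and let $E$ be the set of edges of the nearest-neighbour graph on $\mathbb Z^d$. For $x=(x_e)_{e\in E}\in\mathbb R_+^E$ and $u,v\in\mathbb Z^d$ let $$d_x(u,v)=\inf_{\alpha}\sum_{e\in\alpha}x_e$$ be the first passage time, where the infimum is over all finite nearest-neighbour paths $\alpha$ from $u$ to $v$, and let $|v|=\sum_{i=1}^d|v_i|$ be the $L^1$-norm. Let $0<a<b$ be real numbers, let $p\in[0,1]$, let $\nu=(1-p)\delta_a+p\delta_b$, and let $\mu=\nu^{\otimes E}$ be the product probability measure on $\mathbb R_+^E$. Then there exist constants $C_1,C_2>0$, depending only on $d,a,b,p$, such that for every $v\in\mathbb Z^d$ with $|v|\ge 2$ the function $x\mapsto d_x(0,v)$ is $\mu$-integrable and, for every real $t>0$, $$\mu\left(\left|d_x(0,v)-\int d_y(0,v)\,d\mu(y)\right|>t\sqrt{\frac{|v|}{\log|v|}}\right)\le C_1e^{-C_2t}.$$ -/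

import Mathlib

open MeasureTheory ProbabilityTheory
open scoped NNReal

namespace FPP

/-- The `L¹`-norm `|v|` of a vertex of `ℤ^d`. -/
def l1Norm {d : ℕ} (v : Fin d → ℤ) : ℕ := ∑ i, (v i).natAbs

/-- The nearest-neighbour graph on `ℤ^d`. -/
def lattice (d : ℕ) : SimpleGraph (Fin d → ℤ) where
  Adj u v := l1Norm (u - v) = 1
  symm := ⟨fun u v h => by
    rw [← h]
    refine Finset.sum_congr rfl fun i _ => ?_
    simp only [Pi.sub_apply]
    omega⟩
  loopless := ⟨fun u h => by simp [l1Norm] at h⟩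

/-- The set `E` of (unoriented) edges of `ℤ^d`. -/
abbrev Edge (d : ℕ) : Type := (lattice d).edgeSet

/-- The time `∑_{e ∈ α} x_e` needed to go through the path `α`. -/
def pathTime {d : ℕ} (x : Edge d → ℝ≥0) {u v : Fin d → ℤ} (α : (lattice d).Walk u v) : ℝ≥0 :=
  (α.darts.map fun e => x ⟨e.edge, e.edge_mem⟩).sum

/-- The first passage time `d_x(u, v)`, the infimum of the times of the paths from `u` to `v`. -/
noncomputable def passageTime {d : ℕ} (x : Edge d → ℝ≥0) (u v : Fin d → ℤ) : ℝ :=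
  ⨅ α : (lattice d).Walk u v, (pathTime x α : ℝ)

/-- The product measure `μ = ν^{⊗ E}` on `ℝ₊^E` with `ν = (1 - p) δ_a + p δ_b`. -/
noncomputable def bernoulliFPP (d : ℕ) (a b : ℝ≥0) (p : unitInterval) :
    Measure (Edge d → ℝ≥0) :=
  Measure.infinitePi fun _ => bernoulliMeasure b a p

end FPP

namespace FPP

section Mean

variable {Ω : Type*}

/-- A positive normalized linear functional on real functions. -/
structure IsMean (Φ : (Ω → ℝ) →ₗ[ℝ] ℝ) : Prop where
  nonneg : ∀ f : Ω → ℝ, (∀ x, 0 ≤ f x) → 0 ≤ Φ f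
  one : Φ (fun _ => 1) = 1

namespace IsMean

variable {Φ : (Ω → ℝ) →ₗ[ℝ] ℝ}

lemma mono (h : IsMean Φ) {f g : Ω → ℝ} (hfg : ∀ x, f x ≤ g x) : Φ f ≤ Φ g := by
  have := h.nonneg (g - f) fun x => by simpa using hfg x
  rw [map_sub] at this
  linarith

lemma map_const (h : IsMean Φ) (c : ℝ) : Φ (fun _ => c) = c := by
  have : (fun _ : Ω => c) = c • (fun _ => (1 : ℝ)) := by ext; simp
  rw [this, map_smul, h.one, smul_eq_mul, mul_one]

/-- The Cauchy–Schwarz inequality. -/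
lemma sq_map_mul_le (h : IsMean Φ) (f g : Ω → ℝ) :
    Φ (fun x => f x * g x) ^ 2 ≤ Φ (fun x => f x ^ 2) * Φ (fun x => g x ^ 2) := by
  have key : ∀ t : ℝ, 0 ≤ Φ (fun x => g x ^ 2) * (t * t) + 2 * Φ (fun x => f x * g x) * t +
      Φ (fun x => f x ^ 2) := by
    intro t
    have h0 := h.nonneg (fun x => (f x + t * g x) ^ 2) fun x => sq_nonneg _
    have e : (fun x => (f x + t * g x) ^ 2) = (t * t) • (fun x => g x ^ 2) +
        (2 * t) • (fun x => f x * g x) + (fun x => f x ^ 2) := by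
      ext x; simp; ring
    rw [e, map_add, map_add, map_smul, map_smul, smul_eq_mul, smul_eq_mul] at h0
    linarith
  have := discrim_le_zero key
  rw [discrim] at this
  linarith

lemma map_mul_le_sqrt (h : IsMean Φ) (f g : Ω → ℝ) :
    Φ (fun x => f x * g x) ≤ √(Φ (fun x => f x ^ 2)) * √(Φ (fun x => g x ^ 2)) := by
  rw [← Real.sqrt_mul (h.nonneg _ fun x => sq_nonneg _)]
  exact Real.le_sqrt_of_sq_le (h.sq_map_mul_le f g)

lemma sq_map_le (h : IsMean Φ) (f : Ω → ℝ) : Φ f ^ 2 ≤ Φ (fun x => f x ^ 2) := by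
  have := h.sq_map_mul_le f (fun _ => 1)
  simpa [h.one] using this

lemma map_le_sqrt (h : IsMean Φ) (f : Ω → ℝ) : Φ f ≤ √(Φ (fun x => f x ^ 2)) :=
  Real.le_sqrt_of_sq_le (h.sq_map_le f)

/-- The reverse triangle inequality for the `L²` seminorm of `Φ`. -/
lemma sq_sqrt_sub_sqrt_le (h : IsMean Φ) (f g : Ω → ℝ) :
    (√(Φ (fun x => f x ^ 2)) - √(Φ (fun x => g x ^ 2))) ^ 2 ≤ Φ (fun x => (f x - g x) ^ 2) := by
  have e : (fun x => (f x - g x) ^ 2) = (fun x => f x ^ 2) - (2 : ℝ) • (fun x => f x * g x) +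
      (fun x => g x ^ 2) := by
    ext x; simp; ring
  rw [e, map_add, map_sub, map_smul, smul_eq_mul]
  have h1 := h.map_mul_le_sqrt f g
  have h2 := Real.sq_sqrt (h.nonneg (fun x => f x ^ 2) fun x => sq_nonneg _)
  have h3 := Real.sq_sqrt (h.nonneg (fun x => g x ^ 2) fun x => sq_nonneg _)
  nlinarith

/-- A lower bound for the entropy of `V ^ 2` in terms of the `L¹` and `L²` norms of `V`. -/
lemma le_entropy_sq (h : IsMean Φ) (V : Ω → ℝ) {l : ℝ} (hl : 0 < l) :
    Φ (fun x => V x ^ 2) * (1 + Real.log l) - l * Φ (fun x => |V x|) ^ 2 ≤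
      Φ (fun x => V x ^ 2 * Real.log (V x ^ 2)) -
        Φ (fun x => V x ^ 2) * Real.log (Φ (fun x => V x ^ 2)) := by
  set w := Φ (fun x => V x ^ 2) with hw
  set m := Φ (fun x => |V x|) with hm
  have hw0 : 0 ≤ w := h.nonneg _ fun x => sq_nonneg _
  rcases hw0.eq_or_lt with hw0 | hw0
  · have hm0 : m ^ 2 ≤ 0 := by
      have := h.sq_map_le (fun x => |V x|)
      simp only [sq_abs] at this
      rw [← hm, ← hw, ← hw0] at this
      exact this
    have hm1 : m ^ 2 = 0 := le_antisymm hm0 (sq_nonneg _)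
    rw [← hw0, hm1]
    have hz : (0 : ℝ) ≤ Φ (fun x => V x ^ 2 * Real.log (V x ^ 2)) := by
      have hle : ∀ x, V x ^ 2 - |V x| ≤ V x ^ 2 * Real.log (V x ^ 2) / 2 := by
        intro x
        rcases eq_or_ne (V x) 0 with hV | hV
        · simp [hV]
        · have hp : 0 < |V x| := abs_pos.2 hV
          have h1 := Real.one_sub_inv_le_log_of_pos hp
          have h2 : Real.log (V x ^ 2) = 2 * Real.log |V x| := by
            rw [← sq_abs, Real.log_pow]; norm_num
          rw [h2, ← sq_abs]
          have h3 := mul_le_mul_of_nonneg_left h1 (sq_nonneg |V x|)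
          have h4 : |V x| ^ 2 * (1 - |V x|⁻¹) = |V x| ^ 2 - |V x| := by field_simp
          linarith
      have h1 := h.mono hle
      have e1 : (fun x => V x ^ 2 - |V x|) = (fun x => V x ^ 2) - fun x => |V x| := rfl
      have e2 : (fun x => V x ^ 2 * Real.log (V x ^ 2) / 2) =
          (1 / 2 : ℝ) • fun x => V x ^ 2 * Real.log (V x ^ 2) := by
        ext x; simp; ring
      rw [e1, e2, map_sub, map_smul, ← hw, ← hm, ← hw0, smul_eq_mul] at h1
      have : m = 0 := by simpa using hm1
      rw [this] at h1
      linarith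
    simpa using hz
  · set c := √(l * w) with hc
    have hc0 : 0 < c := Real.sqrt_pos.2 (mul_pos hl hw0)
    have hc2 : c ^ 2 = l * w := Real.sq_sqrt (mul_pos hl hw0).le
    have hlogc : 2 * Real.log c = Real.log l + Real.log w := by
      rw [← Real.log_mul hl.ne' hw0.ne', ← hc2, Real.log_pow]; norm_num
    have hle : ∀ x, (Real.log l + Real.log w + 2) * V x ^ 2 - 2 * c * |V x| ≤
        V x ^ 2 * Real.log (V x ^ 2) := by
      intro x
      rcases eq_or_ne (V x) 0 with hV | hV
      · simp [hV]
      · have hp : 0 < |V x| := abs_pos.2 hV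
        have h1 := Real.one_sub_inv_le_log_of_pos (div_pos hp hc0)
        have h2 : Real.log (V x ^ 2) = 2 * Real.log |V x| := by
          rw [← sq_abs, Real.log_pow]; norm_num
        rw [Real.log_div hp.ne' hc0.ne'] at h1
        rw [h2, ← sq_abs]
        have h3 := mul_le_mul_of_nonneg_left h1 (sq_nonneg |V x|)
        have h4 : |V x| ^ 2 * (1 - (|V x| / c)⁻¹) = |V x| ^ 2 - c * |V x| := by field_simp
        rw [h4] at h3
        rw [← hlogc]
        linarith
    have h1 := h.mono hle
    have e1 : (fun x => (Real.log l + Real.log w + 2) * V x ^ 2 - 2 * c * |V x|) =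
        (Real.log l + Real.log w + 2) • (fun x => V x ^ 2) - (2 * c) • fun x => |V x| := rfl
    rw [e1, map_sub, map_smul, map_smul, ← hw, ← hm, smul_eq_mul, smul_eq_mul] at h1
    have h2 : 2 * c * m ≤ w + l * m ^ 2 := by
      have hs := Real.sqrt_mul hl.le w
      have h3 := Real.sq_sqrt hl.le
      have h4 := Real.sq_sqrt hw0.le
      have h5 := sq_nonneg (√w - √l * m)
      have h6 : c = √l * √w := by rw [hc, hs]
      rw [h6]
      nlinarith
    linarith

end IsMean

end Mean

section Cube

open Function

variable {ι : Type*} [DecidableEq ι]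

/-- The average of a function on the cube over the `p`-biased coordinate `e`. -/
def resample (p : ℝ) (e : ι) : ((ι → Bool) → ℝ) →ₗ[ℝ] ((ι → Bool) → ℝ) where
  toFun g x := (1 - p) * g (update x e false) + p * g (update x e true)
  map_add' f g := by ext x; simp; ring
  map_smul' c g := by ext x; simp; ring

lemma resample_apply (p : ℝ) (e : ι) (g : (ι → Bool) → ℝ) (x : ι → Bool) :
    resample p e g x = (1 - p) * g (update x e false) + p * g (update x e true) := rfl

/-- The discrete derivative of a function on the cube in the direction `e`. -/
def discDeriv (e : ι) (g : (ι → Bool) → ℝ) (x : ι → Bool) : ℝ :=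
  g (update x e true) - g (update x e false)

/-- The average of a function on the cube over the coordinates in a list. -/
def resampleList (p : ℝ) : List ι → (((ι → Bool) → ℝ) →ₗ[ℝ] ((ι → Bool) → ℝ))
  | [] => LinearMap.id
  | e :: l => resample p e ∘ₗ resampleList p l

/-- The mean of a function over the `p`-biased coordinates in `l`, the others being those of `x`. -/
def cubeMean (p : ℝ) (l : List ι) (x : ι → Bool) : ((ι → Bool) → ℝ) →ₗ[ℝ] ℝ :=
  LinearMap.proj x ∘ₗ resampleList p l

lemma cubeMean_nil (p : ℝ) (x : ι → Bool) (g : (ι → Bool) → ℝ) : cubeMean p [] x g = g x := rfl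

lemma cubeMean_cons (p : ℝ) (e : ι) (l : List ι) (x : ι → Bool) (g : (ι → Bool) → ℝ) :
    cubeMean p (e :: l) x g = (1 - p) * cubeMean p l (update x e false) g +
      p * cubeMean p l (update x e true) g := rfl

lemma isMean_cubeMean {p : ℝ} (hp0 : 0 ≤ p) (hp1 : p ≤ 1) (l : List ι) (x : ι → Bool) :
    IsMean (cubeMean p l x) := by
  induction l generalizing x with
  | nil => exact ⟨fun f hf => hf x, rfl⟩
  | cons e l ih =>
    refine ⟨fun f hf => ?_, ?_⟩
    · rw [cubeMean_cons]
      have h1 := (ih (update x e false)).nonneg f hf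
      have h2 := (ih (update x e true)).nonneg f hf
      have h3 := sub_nonneg.2 hp1
      positivity
    · rw [cubeMean_cons, (ih _).one, (ih _).one]; ring

lemma cubeMean_comp_update (p : ℝ) {e : ι} {l : List ι} (he : e ∉ l) (c : Bool) (x : ι → Bool)
    (g : (ι → Bool) → ℝ) :
    cubeMean p l x (fun y => g (update y e c)) = cubeMean p l (update x e c) g := by
  induction l generalizing x with
  | nil => rfl
  | cons e' l ih =>
    have hne : e ≠ e' := fun h => he (by simp [h])
    have hl : e ∉ l := fun h => he (by simp [h])
    rw [cubeMean_cons, cubeMean_cons, ih hl, ih hl, update_comm hne.symm, update_comm hne.symm]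

lemma cubeMean_cons' (p : ℝ) {e : ι} {l : List ι} (he : e ∉ l) (x : ι → Bool)
    (g : (ι → Bool) → ℝ) :
    cubeMean p (e :: l) x g = cubeMean p l x (resample p e g) := by
  rw [cubeMean_cons, ← cubeMean_comp_update p he, ← cubeMean_comp_update p he]
  have : resample p e g = (1 - p) • (fun y => g (update y e false)) +
      p • (fun y => g (update y e true)) := rfl
  rw [this, map_add, map_smul, map_smul, smul_eq_mul, smul_eq_mul]

/-- A function that does not depend on `e` is not affected by averaging over `e`. -/
lemma cubeMean_cons_of_update (p : ℝ) {e : ι} {l : List ι} (he : e ∉ l) (x : ι → Bool)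
    {g : (ι → Bool) → ℝ} (hg : ∀ y c, g (update y e c) = g y) :
    cubeMean p (e :: l) x g = cubeMean p l x g := by
  rw [cubeMean_cons' p he]
  congr 1
  ext y
  rw [resample_apply, hg, hg]; ring

/-- The mean of `h` restricted to the event that the coordinate `e` is `false`. -/
lemma cubeMean_indicator (p : ℝ) {e : ι} {l : List ι} (hl : l.Nodup) (he : e ∈ l) (x : ι → Bool)
    (h : (ι → Bool) → ℝ) :
    cubeMean p l x (fun y => if y e = false then h y else 0) =
      (1 - p) * cubeMean p l x (fun y => h (update y e false)) := by
  induction l generalizing x with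
  | nil => simp at he
  | cons e' l ih =>
    rw [List.nodup_cons] at hl
    by_cases hee : e' = e
    · subst hee
      rw [cubeMean_cons_of_update p hl.1 x (g := fun y => h (update y e' false)) (by simp),
        cubeMean_cons' p hl.1]
      have : resample p e' (fun y => if y e' = false then h y else 0) =
          (1 - p) • fun y => h (update y e' false) := by
        ext y; simp [resample_apply]
      rw [this, map_smul, smul_eq_mul]
    · have he' : e ∈ l := by
        rcases List.mem_cons.1 he with h | h
        · exact absurd h.symm hee
        · exact h
      rw [cubeMean_cons, cubeMean_cons, ih hl.2 he', ih hl.2 he']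
      ring

lemma two_point_entropy_le {p : ℝ} (hp0 : 0 ≤ p) (hp1 : p ≤ 1) (u v : ℝ) :
    (1 - p) * (u ^ 2 * Real.log (u ^ 2)) + p * (v ^ 2 * Real.log (v ^ 2)) -
      ((1 - p) * u ^ 2 + p * v ^ 2) * Real.log ((1 - p) * u ^ 2 + p * v ^ 2) ≤
      2 * (v - u) ^ 2 := by
  set M := (1 - p) * u ^ 2 + p * v ^ 2 with hM
  have hq := sub_nonneg.2 hp1
  have h1 : 0 ≤ (1 - p) * u ^ 2 := by positivity
  have h2 : 0 ≤ p * v ^ 2 := by positivity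
  rcases (add_nonneg h1 h2).eq_or_lt with h0 | h0
  · have e1 : (1 - p) * u ^ 2 = 0 := by linarith
    have e2 : p * v ^ 2 = 0 := by linarith
    rw [← mul_assoc, ← mul_assoc, e1, e2, hM, ← h0]
    simp only [zero_mul]
    have := sq_nonneg (v - u)
    linarith
  · rw [← hM] at h0
    have key : ∀ s : ℝ, s ^ 2 * Real.log (s ^ 2) ≤ s ^ 2 * Real.log M + s ^ 2 * (s ^ 2 / M - 1) := by
      intro s
      rcases eq_or_ne s 0 with hs | hs
      · simp [hs]
      · have hs2 : 0 < s ^ 2 := by positivity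
        have := Real.log_le_sub_one_of_pos (div_pos hs2 h0)
        rw [Real.log_div hs2.ne' h0.ne'] at this
        have := mul_le_mul_of_nonneg_left this hs2.le
        linarith
    have k1 := mul_le_mul_of_nonneg_left (key u) hq
    have k2 := mul_le_mul_of_nonneg_left (key v) hp0
    have e : (1 - p) * (u ^ 2 * (u ^ 2 / M - 1)) + p * (v ^ 2 * (v ^ 2 / M - 1)) =
        p * (1 - p) * (v + u) ^ 2 * (v - u) ^ 2 / M := by
      field_simp
      rw [hM]; ring
    have h3 : p * (1 - p) * (v + u) ^ 2 * (v - u) ^ 2 / M ≤ 2 * (v - u) ^ 2 := by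
      rw [div_le_iff₀ h0]
      have h4 : p * (1 - p) * (v + u) ^ 2 ≤ 2 * M := by
        have a1 : (v + u) ^ 2 ≤ 2 * v ^ 2 + 2 * u ^ 2 := by nlinarith [sq_nonneg (v - u)]
        have a2 := mul_le_mul_of_nonneg_left a1 (mul_nonneg hp0 hq)
        have a3 : 0 ≤ p * (p * v ^ 2) := by positivity
        have a4 : 0 ≤ (1 - p) * ((1 - p) * u ^ 2) := by positivity
        rw [hM]
        nlinarith
      have := mul_le_mul_of_nonneg_right h4 (sq_nonneg (v - u))
      linarith
    have e' : M * Real.log M = (1 - p) * (u ^ 2 * Real.log M) + p * (v ^ 2 * Real.log M) := by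
      rw [hM]; ring
    linarith

lemma discDeriv_update_self (e : ι) (g : (ι → Bool) → ℝ) (x : ι → Bool) (c : Bool) :
    discDeriv e g (update x e c) = discDeriv e g x := by
  simp [discDeriv]

lemma discDeriv_resample (p : ℝ) {e e' : ι} (h : e ≠ e') (g : (ι → Bool) → ℝ) (x : ι → Bool) :
    discDeriv e (resample p e' g) x = resample p e' (discDeriv e g) x := by
  simp only [discDeriv, resample_apply]
  rw [update_comm h, update_comm h, update_comm h, update_comm h]
  ring

lemma discDeriv_resample_self (p : ℝ) (e : ι) (g : (ι → Bool) → ℝ) (x : ι → Bool) :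
    discDeriv e (resample p e g) x = 0 := by
  simp [discDeriv, resample_apply]

lemma discDeriv_sub (e : ι) (f g : (ι → Bool) → ℝ) (x : ι → Bool) :
    discDeriv e (fun y => f y - g y) x = discDeriv e f x - discDeriv e g x := by
  simp only [discDeriv]; ring

/-- The logarithmic Sobolev inequality on the biased cube. -/
theorem entropy_sq_le {p : ℝ} (hp0 : 0 ≤ p) (hp1 : p ≤ 1) {l : List ι} (hl : l.Nodup)
    (x : ι → Bool) (g : (ι → Bool) → ℝ) :
    cubeMean p l x (fun y => g y ^ 2 * Real.log (g y ^ 2)) -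
      cubeMean p l x (fun y => g y ^ 2) * Real.log (cubeMean p l x (fun y => g y ^ 2)) ≤
      2 * (l.map fun e => cubeMean p l x (fun y => discDeriv e g y ^ 2)).sum := by
  induction l generalizing x with
  | nil => simp [cubeMean_nil]
  | cons e l ih =>
    rw [List.nodup_cons] at hl
    have hq := sub_nonneg.2 hp1
    set x0 := update x e false with hx0
    set x1 := update x e true with hx1
    have i0 := mul_le_mul_of_nonneg_left (ih hl.2 x0) hq
    have i1 := mul_le_mul_of_nonneg_left (ih hl.2 x1) hp0
    have n0 := (isMean_cubeMean hp0 hp1 l x0).nonneg (fun y => g y ^ 2) fun y => sq_nonneg _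
    have n1 := (isMean_cubeMean hp0 hp1 l x1).nonneg (fun y => g y ^ 2) fun y => sq_nonneg _
    have t := two_point_entropy_le hp0 hp1 (√(cubeMean p l x0 (fun y => g y ^ 2)))
      (√(cubeMean p l x1 (fun y => g y ^ 2)))
    rw [Real.sq_sqrt n0, Real.sq_sqrt n1] at t
    have s := (isMean_cubeMean hp0 hp1 l x).sq_sqrt_sub_sqrt_le (fun y => g (update y e true))
      (fun y => g (update y e false))
    rw [cubeMean_comp_update p hl.1 true x (fun y => g y ^ 2),
      cubeMean_comp_update p hl.1 false x (fun y => g y ^ 2), ← hx0, ← hx1] at s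
    have d : cubeMean p (e :: l) x (fun y => discDeriv e g y ^ 2) =
        cubeMean p l x (fun y => (g (update y e true) - g (update y e false)) ^ 2) :=
      cubeMean_cons_of_update p hl.1 x (by simp [discDeriv_update_self])
    rw [List.map_cons, List.sum_cons, d]
    have sm : (l.map fun e' => cubeMean p (e :: l) x (fun y => discDeriv e' g y ^ 2)).sum =
        (1 - p) * (l.map fun e' => cubeMean p l x0 (fun y => discDeriv e' g y ^ 2)).sum +
        p * (l.map fun e' => cubeMean p l x1 (fun y => discDeriv e' g y ^ 2)).sum := by
      rw [← List.sum_map_mul_left, ← List.sum_map_mul_left, ← List.sum_map_add]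
      rfl
    rw [sm, cubeMean_cons, cubeMean_cons, ← hx0, ← hx1]
    linarith

lemma abs_sub_resample_le {p : ℝ} (hp0 : 0 ≤ p) (hp1 : p ≤ 1) (e : ι) (g : (ι → Bool) → ℝ)
    (x : ι → Bool) : |g x - resample p e g x| ≤ |discDeriv e g x| := by
  have hq := sub_nonneg.2 hp1
  have hx : x = update x e (x e) := by simp
  rw [resample_apply, discDeriv]
  cases h : x e
  · rw [h] at hx
    have : g x - ((1 - p) * g (update x e false) + p * g (update x e true)) =
        -(p * (g (update x e true) - g (update x e false))) := by
      rw [← hx]; ring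
    rw [this, abs_neg, abs_mul, abs_of_nonneg hp0]
    exact mul_le_of_le_one_left (abs_nonneg _) hp1
  · rw [h] at hx
    have : g x - ((1 - p) * g (update x e false) + p * g (update x e true)) =
        (1 - p) * (g (update x e true) - g (update x e false)) := by
      rw [← hx]; ring
    rw [this, abs_mul, abs_of_nonneg hq]
    exact mul_le_of_le_one_left (abs_nonneg _) (by linarith)

/-- The `L²` norm splits orthogonally under averaging over a coordinate. -/
lemma cubeMean_sq_eq (p : ℝ) {e : ι} {l : List ι} (he : e ∉ l) (x : ι → Bool)
    (g : (ι → Bool) → ℝ) :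
    cubeMean p (e :: l) x (fun y => g y ^ 2) =
      cubeMean p l x (fun y => resample p e g y ^ 2) +
        cubeMean p (e :: l) x (fun y => (g y - resample p e g y) ^ 2) := by
  rw [cubeMean_cons' p he, cubeMean_cons' p he, ← map_add]
  congr 1
  ext y
  simp only [Pi.add_apply, resample_apply, update_idem]
  ring

/-- A Poincaré inequality with a logarithmic gain for functions with small influences. -/
theorem variance_mul_one_add_log_le {p : ℝ} (hp0 : 0 ≤ p) (hp1 : p ≤ 1) {l : List ι}
    (hl : l.Nodup) (x : ι → Bool) (g : (ι → Bool) → ℝ) {r : ℝ} (hr : 0 < r) :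
    (cubeMean p l x (fun y => g y ^ 2) - cubeMean p l x g ^ 2) * (1 + Real.log r) ≤
      2 * (l.map fun e => cubeMean p l x (fun y => discDeriv e g y ^ 2)).sum +
        r * (l.map fun e => cubeMean p l x (fun y => |discDeriv e g y|) ^ 2).sum := by
  induction l generalizing g with
  | nil => simp [cubeMean_nil]
  | cons e l ih =>
    have hl' := hl
    rw [List.nodup_cons] at hl
    have i := ih hl.2 (resample p e g)
    have hV := isMean_cubeMean hp0 hp1 (e :: l) x
    have low := hV.le_entropy_sq (fun y => g y - resample p e g y) hr
    have up := entropy_sq_le hp0 hp1 hl' x (fun y => g y - resample p e g y)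
    rw [List.map_cons, List.sum_cons, List.map_cons, List.sum_cons]
    rw [List.map_cons, List.sum_cons] at up
    have e1 : cubeMean p (e :: l) x
        (fun y => discDeriv e (fun y => g y - resample p e g y) y ^ 2) =
        cubeMean p (e :: l) x (fun y => discDeriv e g y ^ 2) := by
      simp [discDeriv_sub, discDeriv_resample_self]
    have e2 : (l.map fun e' => cubeMean p (e :: l) x (fun y => discDeriv e' g y ^ 2)).sum =
        (l.map fun e' => cubeMean p l x (fun y => discDeriv e' (resample p e g) y ^ 2)).sum +
        (l.map fun e' => cubeMean p (e :: l) x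
          (fun y => discDeriv e' (fun y => g y - resample p e g y) y ^ 2)).sum := by
      rw [← List.sum_map_add]
      congr 1
      refine List.map_congr_left fun e' he' => ?_
      have hne : e' ≠ e := fun h => hl.1 (h ▸ he')
      simp only [discDeriv_sub, discDeriv_resample p hne]
      exact cubeMean_sq_eq p hl.1 x _
    have e3 : (l.map fun e' => cubeMean p l x
          (fun y => |discDeriv e' (resample p e g) y|) ^ 2).sum ≤
        (l.map fun e' => cubeMean p (e :: l) x (fun y => |discDeriv e' g y|) ^ 2).sum := by
      refine List.sum_le_sum fun e' he' => ?_
      have hne : e' ≠ e := fun h => hl.1 (h ▸ he')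
      have hM := isMean_cubeMean hp0 hp1 l x
      refine pow_le_pow_left₀ (hM.nonneg _ fun y => abs_nonneg _) ?_ 2
      rw [cubeMean_cons' p hl.1]
      refine hM.mono fun y => ?_
      rw [discDeriv_resample p hne, resample_apply, resample_apply]
      refine (abs_add_le _ _).trans ?_
      rw [abs_mul, abs_mul, abs_of_nonneg hp0, abs_of_nonneg (sub_nonneg.2 hp1)]
    have e4 : cubeMean p (e :: l) x (fun y => |g y - resample p e g y|) ^ 2 ≤
        cubeMean p (e :: l) x (fun y => |discDeriv e g y|) ^ 2 :=
      pow_le_pow_left₀ (hV.nonneg _ fun y => abs_nonneg _)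
        (hV.mono fun y => abs_sub_resample_le hp0 hp1 e g y) 2
    have e5 := mul_le_mul_of_nonneg_left e3 hr.le
    have e6 := mul_le_mul_of_nonneg_left e4 hr.le
    rw [cubeMean_sq_eq p hl.1, cubeMean_cons' p hl.1 x g, e2]
    rw [e1] at up
    linarith

end Cube

section Exponential

open Function

lemma map_list_sum_fun {Ω κ : Type*} (Φ : (Ω → ℝ) →ₗ[ℝ] ℝ) (l : List κ)
    (f : κ → Ω → ℝ) : Φ (fun y => (l.map fun e => f e y).sum) = (l.map fun e => Φ (f e)).sum := by
  induction l with
  | nil =>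
    have : (fun _ : Ω => (0 : ℝ)) = 0 := rfl
    simp [this]
  | cons e l ih =>
    simp only [List.map_cons, List.sum_cons]
    rw [← ih, ← map_add]
    rfl

variable {ι : Type*} [DecidableEq ι]

lemma sum_cubeMean_mul_discDeriv_le {p : ℝ} (hp0 : 0 ≤ p) (hp1 : p < 1) {l : List ι}
    (hl : l.Nodup) (x : ι → Bool) {F h : (ι → Bool) → ℝ} {S : ℝ}
    (hS : ∀ y, (l.map fun e => if y e = false then discDeriv e F y else 0).sum ≤ S)
    (hh : ∀ y, 0 ≤ h y) :
    (l.map fun e => cubeMean p l x (fun y => h (update y e false) * discDeriv e F y)).sum ≤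
      S / (1 - p) * cubeMean p l x h := by
  have hq : 0 < 1 - p := sub_pos.2 hp1
  have hM := isMean_cubeMean hp0 hp1.le l x
  have e1 : ∀ e ∈ l, cubeMean p l x (fun y => h (update y e false) * discDeriv e F y) =
      (1 - p)⁻¹ *
        cubeMean p l x (fun y => h y * if y e = false then discDeriv e F y else 0) := by
    intro e he
    have := cubeMean_indicator p hl he x (fun y => h y * discDeriv e F y)
    simp only [discDeriv_update_self] at this
    have e2 : (fun y => h y * if y e = false then discDeriv e F y else 0) =
        fun y => if y e = false then h y * discDeriv e F y else 0 := by
      ext y; split_ifs <;> simp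
    rw [e2, this, ← mul_assoc, inv_mul_cancel₀ hq.ne', one_mul]
  rw [List.map_congr_left e1, List.sum_map_mul_left, ← map_list_sum_fun]
  have e3 : cubeMean p l x
      (fun y => (l.map fun e => h y * if y e = false then discDeriv e F y else 0).sum) ≤
      cubeMean p l x (S • h) := by
    refine hM.mono fun y => ?_
    rw [List.sum_map_mul_left, Pi.smul_apply, smul_eq_mul, mul_comm]
    exact mul_le_mul_of_nonneg_right (hS y) (hh y)
  rw [map_smul, smul_eq_mul] at e3
  calc _ ≤ (1 - p)⁻¹ * (S * cubeMean p l x h) :=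
        mul_le_mul_of_nonneg_left e3 (inv_nonneg.2 hq.le)
    _ = _ := by rw [div_eq_mul_inv]; ring

lemma abs_discDeriv_exp_le {F : (ι → Bool) → ℝ} {K t : ℝ} {e : ι} {y : ι → Bool}
    (hD0 : 0 ≤ discDeriv e F y) (hDK : discDeriv e F y ≤ K) (ht : |t| * K ≤ 1) :
    |discDeriv e (fun y => Real.exp (t * F y / 2)) y| ≤
      |t| * (Real.exp (t * F (update y e false) / 2) * discDeriv e F y) := by
  have e1 : discDeriv e (fun y => Real.exp (t * F y / 2)) y =
      Real.exp (t * F (update y e false) / 2) * (Real.exp (t * discDeriv e F y / 2) - 1) := by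
    rw [mul_sub, ← Real.exp_add, discDeriv, discDeriv]
    ring_nf
  have h2 : |t * discDeriv e F y / 2| = |t| * discDeriv e F y / 2 := by
    rw [abs_div, abs_mul, abs_of_nonneg hD0]; norm_num
  have h3 : |t| * discDeriv e F y ≤ 1 := (mul_le_mul_of_nonneg_left hDK (abs_nonneg t)).trans ht
  have h1 := Real.abs_exp_sub_one_le (x := t * discDeriv e F y / 2) (by
    rw [h2]; linarith)
  rw [e1, abs_mul, abs_of_nonneg (Real.exp_nonneg _)]
  rw [h2] at h1
  calc _ ≤ Real.exp (t * F (update y e false) / 2) * (2 * (|t| * discDeriv e F y / 2)) :=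
        mul_le_mul_of_nonneg_left h1 (Real.exp_nonneg _)
    _ = _ := by ring

/-- The variance of `exp (t F / 2)` for a monotone function `F` with small influences. -/
theorem variance_exp_le {p : ℝ} (hp0 : 0 ≤ p) (hp1 : p < 1) {l : List ι}
    (hl : l.Nodup) (x : ι → Bool) {F : (ι → Bool) → ℝ} {K S δ : ℝ} (hS0 : 0 ≤ S)
    (hD0 : ∀ e y, 0 ≤ discDeriv e F y) (hDK : ∀ e y, discDeriv e F y ≤ K)
    (hS : ∀ y, (l.map fun e => if y e = false then discDeriv e F y else 0).sum ≤ S)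
    (hδ : ∀ e ∈ l, cubeMean p l x (discDeriv e F) ≤ δ) {t : ℝ} (ht : |t| * K ≤ 1)
    (hK : 0 ≤ K) {r : ℝ} (hr : 0 < r) :
    (cubeMean p l x (fun y => Real.exp (t * F y)) -
        cubeMean p l x (fun y => Real.exp (t * F y / 2)) ^ 2) * (1 + Real.log r) ≤
      t ^ 2 * S * cubeMean p l x (fun y => Real.exp (t * F y)) *
        (2 * K / (1 - p) + r * √(K * δ) / (1 - p) ^ 2) := by
  have hq : 0 < 1 - p := sub_pos.2 hp1
  have hM := isMean_cubeMean hp0 hp1.le l x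
  set g : (ι → Bool) → ℝ := fun y => Real.exp (t * F y / 2) with hg
  have hg0 : ∀ y, 0 ≤ g y := fun y => Real.exp_nonneg _
  have hg2 : (fun y => Real.exp (t * F y)) = fun y => g y ^ 2 := by
    ext y; rw [hg, ← Real.exp_nat_mul]; congr 1; push_cast; ring
  rw [hg2]
  have main := variance_mul_one_add_log_le hp0 hp1.le hl x g hr
  refine main.trans ?_
  set M := cubeMean p l x (fun y => g y ^ 2) with hMdef
  have hM0 : 0 ≤ M := hM.nonneg _ fun y => sq_nonneg _
  have hder : ∀ e y, |discDeriv e g y| ≤ |t| * (g (update y e false) * discDeriv e F y) :=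
    fun e y => abs_discDeriv_exp_le (hD0 e y) (hDK e y) ht
  -- the energy
  have energy : (l.map fun e => cubeMean p l x (fun y => discDeriv e g y ^ 2)).sum ≤
      t ^ 2 * K * (S / (1 - p) * M) := by
    refine le_trans ?_ (mul_le_mul_of_nonneg_left (sum_cubeMean_mul_discDeriv_le hp0 hp1 hl x hS
      (h := fun y => g y ^ 2) fun y => sq_nonneg _) (by positivity))
    rw [← List.sum_map_mul_left]
    refine List.sum_le_sum fun e _ => ?_
    rw [← smul_eq_mul (t ^ 2 * K), ← map_smul]
    refine hM.mono fun y => ?_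
    rw [Pi.smul_apply, smul_eq_mul, ← sq_abs]
    have h1 := pow_le_pow_left₀ (abs_nonneg _) (hder e y) 2
    refine h1.trans ?_
    have h2 : discDeriv e F y ^ 2 ≤ K * discDeriv e F y := by
      rw [sq]; exact mul_le_mul_of_nonneg_right (hDK e y) (hD0 e y)
    calc (|t| * (g (update y e false) * discDeriv e F y)) ^ 2
        = t ^ 2 * g (update y e false) ^ 2 * discDeriv e F y ^ 2 := by
          rw [← sq_abs t]; ring
      _ ≤ t ^ 2 * g (update y e false) ^ 2 * (K * discDeriv e F y) :=
          mul_le_mul_of_nonneg_left h2 (by positivity)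
      _ = _ := by ring
  -- the influences
  set B : ι → ℝ := fun e => cubeMean p l x (fun y => g (update y e false) * discDeriv e F y)
    with hB
  have hB0 : ∀ e, 0 ≤ B e := fun e =>
    hM.nonneg _ fun y => mul_nonneg (hg0 _) (hD0 e y)
  have hBle : ∀ e, cubeMean p l x (fun y => |discDeriv e g y|) ≤ |t| * B e := by
    intro e
    rw [hB, ← smul_eq_mul, ← map_smul]
    exact hM.mono fun y => hder e y
  have hBmax : ∀ e ∈ l, B e ≤ √M * √(K * δ) / (1 - p) := by
    intro e he
    have h1 := cubeMean_indicator p hl he x (fun y => g y * discDeriv e F y)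
    simp only [discDeriv_update_self] at h1
    have h2 : cubeMean p l x (fun y => if y e = false then g y * discDeriv e F y else 0) ≤
        cubeMean p l x (fun y => g y * discDeriv e F y) := by
      refine hM.mono fun y => ?_
      split_ifs
      · exact le_rfl
      · exact mul_nonneg (hg0 y) (hD0 e y)
    have h3 := hM.map_mul_le_sqrt g (discDeriv e F)
    have h4 : cubeMean p l x (fun y => discDeriv e F y ^ 2) ≤ K * δ := by
      refine le_trans ?_ (mul_le_mul_of_nonneg_left (hδ e he) hK)
      rw [← smul_eq_mul, ← map_smul]
      refine hM.mono fun y => ?_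
      rw [Pi.smul_apply, smul_eq_mul, sq]
      exact mul_le_mul_of_nonneg_right (hDK e y) (hD0 e y)
    rw [le_div_iff₀ hq, mul_comm]
    calc (1 - p) * B e ≤ cubeMean p l x (fun y => g y * discDeriv e F y) := by
          rw [hB, ← h1]; exact h2
      _ ≤ √M * √(cubeMean p l x (fun y => discDeriv e F y ^ 2)) := h3
      _ ≤ √M * √(K * δ) := by gcongr
  have hBsum : (l.map B).sum ≤ S / (1 - p) * √M :=
    (sum_cubeMean_mul_discDeriv_le hp0 hp1 hl x hS hg0).trans
      (mul_le_mul_of_nonneg_left (hM.map_le_sqrt g) (by positivity))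
  have infl : (l.map fun e => cubeMean p l x (fun y => |discDeriv e g y|) ^ 2).sum ≤
      t ^ 2 * (√M * √(K * δ) / (1 - p)) * (S / (1 - p) * √M) := by
    refine le_trans ?_ (mul_le_mul_of_nonneg_left hBsum (by positivity))
    rw [← List.sum_map_mul_left]
    refine List.sum_le_sum fun e he => ?_
    have h1 := pow_le_pow_left₀ (hM.nonneg _ fun y => abs_nonneg _) (hBle e) 2
    refine h1.trans ?_
    rw [mul_pow, sq_abs, mul_assoc, sq (B e)]
    exact mul_le_mul_of_nonneg_left (mul_le_mul_of_nonneg_right (hBmax e he) (hB0 e))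
      (sq_nonneg t)
  have e2 : t ^ 2 * (√M * √(K * δ) / (1 - p)) * (S / (1 - p) * √M) =
      t ^ 2 * S * M * (√(K * δ) / (1 - p) ^ 2) := by
    rw [show t ^ 2 * (√M * √(K * δ) / (1 - p)) * (S / (1 - p) * √M) =
      t ^ 2 * S * (√M * √M) * (√(K * δ) / (1 - p) ^ 2) by field_simp, Real.mul_self_sqrt hM0]
  rw [e2] at infl
  calc _ ≤ 2 * (t ^ 2 * K * (S / (1 - p) * M)) +
        r * (t ^ 2 * S * M * (√(K * δ) / (1 - p) ^ 2)) := by gcongr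
    _ = _ := by field_simp

/-- A recursive variance bound for `exp (t F)` gives a bound of the Laplace transform. -/
theorem laplace_le {Ω : Type*} {Φ : (Ω → ℝ) →ₗ[ℝ] ℝ} (hΦ : IsMean Φ) {F : Ω → ℝ} {B : ℝ}
    (hB : ∀ x, |F x| ≤ B) (hF : Φ F = 0) {k T : ℝ} (hk : 0 ≤ k)
    (hrec : ∀ t, |t| ≤ T → Φ (fun y => Real.exp (t * F y)) -
      Φ (fun y => Real.exp (t * F y / 2)) ^ 2 ≤ k * t ^ 2 * Φ (fun y => Real.exp (t * F y)))
    {t : ℝ} (ht : |t| ≤ T) (hkt : k * t ^ 2 ≤ 1 / 2) :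
    Φ (fun y => Real.exp (t * F y)) ≤ Real.exp (4 * (k * t ^ 2)) := by
  set G : ℝ → ℝ := fun t => Φ (fun y => Real.exp (t * F y)) with hG
  have hG0 : ∀ t, 0 ≤ G t := fun t => hΦ.nonneg _ fun y => Real.exp_nonneg _
  have step : ∀ t, |t| ≤ T → k * t ^ 2 ≤ 1 / 2 →
      G t ≤ G (t / 2) ^ 2 * Real.exp (2 * (k * t ^ 2)) := by
    intro t ht hkt
    have h1 := hrec t ht
    have e1 : (fun y => Real.exp (t * F y / 2)) = fun y => Real.exp (t / 2 * F y) := by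
      ext y; ring_nf
    rw [e1] at h1
    change G t - G (t / 2) ^ 2 ≤ k * t ^ 2 * G t at h1
    set s := k * t ^ 2
    have hs0 : 0 ≤ s := by positivity
    have h2 : 1 ≤ (1 - s) * Real.exp (2 * s) := by
      have := Real.add_one_le_exp (2 * s)
      have := mul_le_mul_of_nonneg_left this (by linarith : 0 ≤ 1 - s)
      nlinarith
    calc G t ≤ G t * ((1 - s) * Real.exp (2 * s)) := le_mul_of_one_le_right (hG0 t) h2
      _ = (G t * (1 - s)) * Real.exp (2 * s) := by ring
      _ ≤ _ := mul_le_mul_of_nonneg_right (by linarith) (Real.exp_nonneg _)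
  have iter : ∀ n : ℕ, ∀ t, |t| ≤ T → k * t ^ 2 ≤ 1 / 2 →
      G t ≤ G (t / 2 ^ n) ^ (2 ^ n) * Real.exp (4 * (k * t ^ 2)) := by
    intro n
    induction n with
    | zero =>
      intro t _ _
      have : 1 ≤ Real.exp (4 * (k * t ^ 2)) := Real.one_le_exp (by positivity)
      simpa using le_mul_of_one_le_right (hG0 t) this
    | succ n ih =>
      intro t ht hkt
      have h1 : |t / 2| ≤ T := by
        rw [abs_div, abs_two]; linarith [abs_nonneg t]
      have h2 : k * (t / 2) ^ 2 ≤ 1 / 2 := by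
        have : 0 ≤ k * t ^ 2 := by positivity
        have : k * (t / 2) ^ 2 = k * t ^ 2 / 4 := by ring
        linarith
      have h3 := pow_le_pow_left₀ (hG0 _) (ih (t / 2) h1 h2) 2
      refine (step t ht hkt).trans ((mul_le_mul_of_nonneg_right h3 (Real.exp_nonneg _)).trans ?_)
      refine le_of_eq ?_
      rw [mul_pow, ← pow_mul, ← pow_succ, ← Real.exp_nat_mul, mul_assoc, ← Real.exp_add]
      congr 2
      · rw [div_div, ← pow_succ']
      · push_cast; ring
  have small : ∀ s, |s| * B ≤ 1 → G s ≤ Real.exp (B ^ 2 * s ^ 2) := by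
    intro s hs
    have h1 : ∀ y, Real.exp (s * F y) ≤ 1 + s * F y + B ^ 2 * s ^ 2 := by
      intro y
      have h2 : |s * F y| ≤ 1 := by
        rw [abs_mul]
        exact (mul_le_mul_of_nonneg_left (hB y) (abs_nonneg s)).trans hs
      have h3 := (abs_le.1 (Real.abs_exp_sub_one_sub_id_le h2)).2
      have h4 : F y ^ 2 ≤ B ^ 2 := sq_le_sq' (abs_le.1 (hB y)).1 (abs_le.1 (hB y)).2
      have h5 := mul_le_mul_of_nonneg_right h4 (sq_nonneg s)
      nlinarith
    have h2 := hΦ.mono h1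
    have e1 : (fun y => 1 + s * F y + B ^ 2 * s ^ 2) =
        (fun _ => 1 + B ^ 2 * s ^ 2) + s • F := by
      ext y; simp; ring
    rw [e1, map_add, map_smul, hF, hΦ.map_const] at h2
    have h3 := Real.add_one_le_exp (B ^ 2 * s ^ 2)
    simp only [smul_zero, add_zero] at h2
    change G s ≤ _ at h2
    linarith
  have lim : Filter.Tendsto (fun n : ℕ => Real.exp (B ^ 2 * t ^ 2 * (1 / 2 : ℝ) ^ n) *
      Real.exp (4 * (k * t ^ 2))) Filter.atTop (nhds (Real.exp (4 * (k * t ^ 2)))) := by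
    have h1 := tendsto_pow_atTop_nhds_zero_of_lt_one (r := (1 / 2 : ℝ)) (by norm_num) (by norm_num)
    have h2 := (Real.continuous_exp.tendsto _).comp (h1.const_mul (B ^ 2 * t ^ 2))
    simpa [Function.comp_def] using h2.mul_const (Real.exp (4 * (k * t ^ 2)))
  refine ge_of_tendsto lim ?_
  have h1 := (tendsto_pow_atTop_nhds_zero_of_lt_one (r := (1 / 2 : ℝ)) (by norm_num)
    (by norm_num)).const_mul (|t| * B)
  rw [mul_zero] at h1
  filter_upwards [h1.eventually_le_const (zero_lt_one)] with n hn
  refine (iter n t ht hkt).trans (mul_le_mul_of_nonneg_right ?_ (Real.exp_nonneg _))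
  have h3 := small (t / 2 ^ n) (by
    rw [abs_div, abs_of_pos (by positivity : (0 : ℝ) < 2 ^ n)]
    calc _ = |t| * B * (1 / 2) ^ n := by rw [one_div, inv_pow]; ring
      _ ≤ 1 := hn)
  refine (pow_le_pow_left₀ (hG0 _) h3 _).trans (le_of_eq ?_)
  rw [← Real.exp_nat_mul]
  congr 1
  rw [one_div, inv_pow]
  push_cast
  field_simp

end Exponential

section CubeMeasure

open Function

variable {ι : Type*}

/-- The product of Bernoulli measures on the cube. -/
noncomputable def cubeMeasure (ι : Type*) (p : unitInterval) : Measure (ι → Bool) :=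
  Measure.infinitePi fun _ => bernoulliMeasure true false p

instance (p : unitInterval) : IsProbabilityMeasure (cubeMeasure ι p) := by
  unfold cubeMeasure; infer_instance

lemma exists_eq_comp_restrict {α : Type*} {g : (ι → Bool) → α} {s : Finset ι}
    (hg : DependsOn g (s : Set ι)) : ∃ g' : (s → Bool) → α, ∀ x, g x = g' (s.restrict x) := by
  classical
  refine ⟨fun z => g fun i => if h : i ∈ s then z ⟨i, h⟩ else false, fun x => hg fun i hi => ?_⟩
  have : i ∈ s := hi
  simp [this]

lemma measurable_of_dependsOn {α : Type*} [MeasurableSpace α] {g : (ι → Bool) → α} {s : Finset ι}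
    (hg : DependsOn g (s : Set ι)) : Measurable g := by
  obtain ⟨g', h⟩ := exists_eq_comp_restrict hg
  have : g = g' ∘ s.restrict := funext h
  rw [this]
  exact (measurable_of_finite g').comp (Finset.measurable_restrict s)

lemma exists_bound_of_dependsOn {g : (ι → Bool) → ℝ} {s : Finset ι}
    (hg : DependsOn g (s : Set ι)) : ∃ C, ∀ x, |g x| ≤ C := by
  obtain ⟨g', h⟩ := exists_eq_comp_restrict hg
  obtain ⟨C, hC⟩ := (Set.finite_range fun z => |g' z|).bddAbove
  exact ⟨C, fun x => by rw [h]; exact hC ⟨_, rfl⟩⟩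

lemma integrable_of_dependsOn (p : unitInterval) {g : (ι → Bool) → ℝ} {s : Finset ι}
    (hg : DependsOn g (s : Set ι)) : Integrable g (cubeMeasure ι p) := by
  obtain ⟨C, hC⟩ := exists_bound_of_dependsOn hg
  exact Integrable.of_bound (measurable_of_dependsOn hg).aestronglyMeasurable C
    (Filter.Eventually.of_forall hC)

/-- The product measure is invariant under permutations of the coordinates. -/
lemma map_comp_cubeMeasure (p : unitInterval) (σ : ι ≃ ι) :
    (cubeMeasure ι p).map (fun x i => x (σ i)) = cubeMeasure ι p := by
  refine Measure.eq_infinitePi _ fun s t ht => ?_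
  rw [Measure.map_apply (by fun_prop) (.pi s.countable_toSet fun i _ => ht i)]
  have : (fun (x : ι → Bool) i => x (σ i)) ⁻¹' ((s : Set ι).pi t) =
      ((s.map σ.toEmbedding : Finset ι) : Set ι).pi fun i => t (σ.symm i) := by
    ext x
    simp only [Set.mem_preimage, Set.mem_pi, Finset.mem_coe, Finset.mem_map_equiv]
    exact ⟨fun h i hi => by simpa using h _ hi, fun h i hi => by simpa using h (σ i) (by simpa)⟩
  rw [this, cubeMeasure, Measure.infinitePi_pi _ fun i _ => ht _]
  simp

lemma integral_comp_cubeMeasure (p : unitInterval) (σ : ι ≃ ι) {g : (ι → Bool) → ℝ}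
    (hg : Measurable g) :
    ∫ x, g (fun i => x (σ i)) ∂(cubeMeasure ι p) = ∫ x, g x ∂(cubeMeasure ι p) := by
  conv_rhs => rw [← map_comp_cubeMeasure p σ]
  rw [integral_map (Measurable.aemeasurable (by fun_prop)) hg.aestronglyMeasurable]

lemma dependsOn_comp {α β : Type*} {g : (ι → Bool) → α} {s : Set ι} (hg : DependsOn g s)
    (φ : α → β) : DependsOn (fun x => φ (g x)) s := fun _ _ h => congrArg φ (hg h)

variable [DecidableEq ι]

lemma measurable_update_prod (e : ι) :
    Measurable fun z : (ι → Bool) × Bool => update z.1 e z.2 := by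
  refine measurable_pi_lambda _ fun i => ?_
  by_cases h : i = e
  · subst h; simpa using measurable_snd
  · simp only [update_of_ne h]
    exact (measurable_pi_apply i).comp measurable_fst

lemma map_update_cubeMeasure (p : unitInterval) (e : ι) :
    ((cubeMeasure ι p).prod (bernoulliMeasure true false p)).map
      (fun z => update z.1 e z.2) = cubeMeasure ι p := by
  refine Measure.eq_infinitePi _ fun s t ht => ?_
  rw [Measure.map_apply (measurable_update_prod e) (.pi s.countable_toSet fun i _ => ht i)]
  have : (fun z : (ι → Bool) × Bool => update z.1 e z.2) ⁻¹' ((s : Set ι).pi t) =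
      (((s.erase e : Finset ι) : Set ι).pi t) ×ˢ (if e ∈ s then t e else Set.univ) := by
    ext z
    simp only [Set.mem_preimage, Set.mem_pi, Set.mem_prod, Finset.mem_coe, Finset.mem_erase]
    constructor
    · intro h
      refine ⟨fun i hi => by simpa [update_of_ne hi.1] using h i hi.2, ?_⟩
      split_ifs with he
      · simpa using h e he
      · trivial
    · rintro ⟨h1, h2⟩ i hi
      by_cases hie : i = e
      · subst hie; simpa [hi] using h2
      · simpa [update_of_ne hie] using h1 i ⟨hie, hi⟩
  rw [this, Measure.prod_prod, cubeMeasure, Measure.infinitePi_pi _ fun i _ => ht i]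
  split_ifs with he
  · rw [mul_comm, Finset.mul_prod_erase s (fun i => bernoulliMeasure true false p (t i)) he]
  · rw [Finset.erase_eq_of_notMem he, measure_univ, mul_one]

lemma dependsOn_resample (p : ℝ) (e : ι) {g : (ι → Bool) → ℝ} {s : Set ι}
    (hg : DependsOn g s) : DependsOn (resample p e g) (s \ {e}) := by
  intro x y h
  have : ∀ c, g (update x e c) = g (update y e c) := fun c => hg fun i hi => by
    by_cases hie : i = e
    · subst hie; simp
    · simpa [update_of_ne hie] using h i ⟨hi, hie⟩
  rw [resample_apply, resample_apply, this, this]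

lemma integral_resample (p : unitInterval) (e : ι) {g : (ι → Bool) → ℝ} {s : Finset ι}
    (hg : DependsOn g (s : Set ι)) :
    ∫ x, resample p e g x ∂(cubeMeasure ι p) = ∫ x, g x ∂(cubeMeasure ι p) := by
  obtain ⟨C, hC⟩ := exists_bound_of_dependsOn hg
  have hm := measurable_of_dependsOn hg
  conv_rhs => rw [← map_update_cubeMeasure p e]
  rw [integral_map (measurable_update_prod e).aemeasurable hm.aestronglyMeasurable,
    integral_prod]
  · refine integral_congr_ae (Filter.Eventually.of_forall fun x => ?_)
    simp only
    rw [integral_bernoulliMeasure, resample_apply]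
    simp only [smul_eq_mul]
    ring
  · exact Integrable.of_bound (hm.comp (measurable_update_prod e)).aestronglyMeasurable C
      (Filter.Eventually.of_forall fun _ => hC _)

lemma dependsOn_resampleList (p : ℝ) (l : List ι) {g : (ι → Bool) → ℝ} {s : Set ι}
    (hg : DependsOn g s) : DependsOn (resampleList p l g) (s \ {e | e ∈ l}) := by
  induction l with
  | nil => exact hg.mono (by simp)
  | cons e l ih =>
    refine (dependsOn_resample p e ih).mono fun i hi => ?_
    simp only [Set.mem_sdiff, Set.mem_ofPred_eq, List.mem_cons, Set.mem_singleton_iff] at hi ⊢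
    tauto

lemma integral_resampleList (p : unitInterval) (l : List ι) {g : (ι → Bool) → ℝ} {s : Finset ι}
    (hg : DependsOn g (s : Set ι)) :
    ∫ x, resampleList p l g x ∂(cubeMeasure ι p) = ∫ x, g x ∂(cubeMeasure ι p) := by
  induction l with
  | nil => rfl
  | cons e l ih =>
    rw [← ih]
    exact integral_resample p e
      ((dependsOn_resampleList (p : ℝ) l hg).mono (t := (s : Set ι)) fun i hi => hi.1)

lemma integral_eq_cubeMean (p : unitInterval) {g : (ι → Bool) → ℝ} {s : Finset ι}
    (hg : DependsOn g (s : Set ι)) (x : ι → Bool) :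
    ∫ y, g y ∂(cubeMeasure ι p) = cubeMean (p : ℝ) s.toList x g := by
  rw [← integral_resampleList p s.toList hg]
  have : ∀ y, resampleList (p : ℝ) s.toList g y = cubeMean (p : ℝ) s.toList x g := fun y =>
    (dependsOn_resampleList (p : ℝ) s.toList hg) (by simp)
  simp [this]

lemma dependsOn_discDeriv (e : ι) {g : (ι → Bool) → ℝ} {s : Set ι} (hg : DependsOn g s) :
    DependsOn (discDeriv e g) s := by
  intro x y h
  have : ∀ c, g (update x e c) = g (update y e c) := fun c => hg fun i hi => by
    by_cases hie : i = e
    · subst hie; simp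
    · simpa [update_of_ne hie] using h i hi
  rw [discDeriv, discDeriv, this, this]

/-- Exponential concentration of a monotone function on the cube with small influences. -/
theorem cube_concentration {p : unitInterval} (hp1 : (p : ℝ) < 1) {s : Finset ι}
    {F : (ι → Bool) → ℝ} (hF : DependsOn F (s : Set ι)) {K S δ : ℝ} (hS0 : 0 ≤ S) (hK : 0 ≤ K)
    (hD0 : ∀ e y, 0 ≤ discDeriv e F y) (hDK : ∀ e y, discDeriv e F y ≤ K)
    (hS : ∀ y, ∑ e ∈ s, (if y e = false then discDeriv e F y else 0) ≤ S)
    (hδ : ∀ e ∈ s, ∫ y, discDeriv e F y ∂(cubeMeasure ι p) ≤ δ)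
    {r k : ℝ} (hr : 0 < r) (hr1 : 0 < 1 + Real.log r) (hk0 : 0 ≤ k)
    (hk : S * (2 * K / (1 - p) + r * √(K * δ) / (1 - p) ^ 2) ≤ k * (1 + Real.log r))
    {t : ℝ} (ht0 : 0 ≤ t) (ht : t * K ≤ 1) (hkt : k * t ^ 2 ≤ 1 / 2) (u : ℝ) :
    (cubeMeasure ι p).real {x | u < |F x - ∫ y, F y ∂(cubeMeasure ι p)|} ≤
      2 * Real.exp 2 * Real.exp (-(t * u)) := by
  set μ := cubeMeasure ι p with hμ
  set m := ∫ y, F y ∂μ with hm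
  let x0 : ι → Bool := fun _ => false
  have hM := isMean_cubeMean p.2.1 p.2.2 s.toList x0
  set Φ := cubeMean (p : ℝ) s.toList x0 with hΦ
  set G : (ι → Bool) → ℝ := fun x => F x - m with hG
  have hGdep : DependsOn G (s : Set ι) := dependsOn_comp hF fun a => a - m
  have hGD : ∀ e, discDeriv e G = discDeriv e F := by
    intro e; ext y; simp [discDeriv, hG]
  obtain ⟨B, hB⟩ := exists_bound_of_dependsOn hGdep
  have hΦG : Φ G = 0 := by
    rw [← integral_eq_cubeMean p hGdep x0, ← hμ, hG,
      integral_sub (integrable_of_dependsOn p hF) (integrable_const _), ← hm]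
    simp
  have hrec : ∀ a, |a| ≤ t → Φ (fun y => Real.exp (a * G y)) -
      Φ (fun y => Real.exp (a * G y / 2)) ^ 2 ≤ k * a ^ 2 * Φ (fun y => Real.exp (a * G y)) := by
    intro a ha
    have h1 := variance_exp_le (F := G) (K := K) (S := S) (δ := δ) p.2.1 hp1 s.nodup_toList x0 hS0
      (by simpa [hGD] using hD0) (by simpa [hGD] using hDK)
      (by
        intro y
        rw [Finset.sum_map_toList]
        simpa [hGD] using hS y)
      (by
        intro e he
        rw [hGD, ← integral_eq_cubeMean p (dependsOn_discDeriv e hF) x0]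
        exact hδ e (Finset.mem_toList.1 he))
      (t := a) ((mul_le_mul_of_nonneg_right ha hK).trans ht) hK hr
    rw [← hΦ] at h1
    have h0 : 0 ≤ Φ (fun y => Real.exp (a * G y)) := hM.nonneg _ fun y => Real.exp_nonneg _
    have h2 : (Φ (fun y => Real.exp (a * G y)) -
        Φ (fun y => Real.exp (a * G y / 2)) ^ 2) * (1 + Real.log r) ≤
        k * a ^ 2 * Φ (fun y => Real.exp (a * G y)) * (1 + Real.log r) := by
      refine h1.trans ?_
      have := mul_le_mul_of_nonneg_left hk (mul_nonneg (sq_nonneg a) h0)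
      linarith
    exact le_of_mul_le_mul_right h2 hr1
  have lap : ∀ a, |a| = t → ∫ y, Real.exp (a * G y) ∂μ ≤ Real.exp 2 := by
    intro a ha
    have ha2 : a ^ 2 = t ^ 2 := by rw [← sq_abs, ha]
    have h1 := laplace_le hM hB hΦG hk0 hrec ha.le (by rw [ha2]; exact hkt)
    rw [hμ, integral_eq_cubeMean p (dependsOn_comp hGdep fun z => Real.exp (a * z)) x0]
    refine h1.trans (Real.exp_le_exp.2 ?_)
    rw [ha2]; linarith
  have int : ∀ a, Integrable (fun y => Real.exp (a * G y)) μ := fun a =>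
    integrable_of_dependsOn p (dependsOn_comp hGdep fun z => Real.exp (a * z))
  have hmk := mul_meas_ge_le_integral_of_nonneg (μ := μ)
    (f := fun y => Real.exp (t * G y) + Real.exp (-t * G y))
    (Filter.Eventually.of_forall fun y => by positivity) ((int t).add (int (-t)))
    (Real.exp (t * u))
  have hsum : ∫ y, (Real.exp (t * G y) + Real.exp (-t * G y)) ∂μ ≤ 2 * Real.exp 2 := by
    rw [integral_add (int t) (int (-t))]
    have h1 := lap t (abs_of_nonneg ht0)
    have h2 := lap (-t) (by rw [abs_neg, abs_of_nonneg ht0])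
    linarith
  have hsub : {x | u < |F x - m|} ⊆
      {x | Real.exp (t * u) ≤ Real.exp (t * G x) + Real.exp (-t * G x)} := by
    intro x hx
    have hx' : u < |G x| := hx
    have h1 : Real.exp (t * u) ≤ Real.exp (t * |G x|) :=
      Real.exp_le_exp.2 (mul_le_mul_of_nonneg_left hx'.le ht0)
    refine h1.trans ?_
    rcases abs_cases (G x) with h | h
    · rw [h.1]; linarith [Real.exp_nonneg (-t * G x)]
    · rw [h.1, mul_neg, ← neg_mul]; linarith [Real.exp_nonneg (t * G x)]
  have hle := measureReal_mono (μ := μ) hsub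
  have hpos := Real.exp_pos (t * u)
  have h3 : μ.real {x | u < |F x - m|} * Real.exp (t * u) ≤ 2 * Real.exp 2 := by
    calc _ ≤ Real.exp (t * u) *
          μ.real {x | Real.exp (t * u) ≤ Real.exp (t * G x) + Real.exp (-t * G x)} := by
          rw [mul_comm]; gcongr
      _ ≤ _ := hmk.trans hsum
  rw [Real.exp_neg, ← div_eq_mul_inv, le_div_iff₀ hpos]
  exact h3

end CubeMeasure

section Lattice

variable {d : ℕ}

lemma l1Norm_neg (u : Fin d → ℤ) : l1Norm (-u) = l1Norm u := by
  simp [l1Norm]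

lemma l1Norm_sub_comm (u v : Fin d → ℤ) : l1Norm (u - v) = l1Norm (v - u) := by
  rw [← l1Norm_neg, neg_sub]

lemma l1Norm_zero : l1Norm (0 : Fin d → ℤ) = 0 := by
  simp [l1Norm]

lemma l1Norm_add_le (u v : Fin d → ℤ) : l1Norm (u + v) ≤ l1Norm u + l1Norm v := by
  rw [l1Norm, l1Norm, l1Norm, ← Finset.sum_add_distrib]
  exact Finset.sum_le_sum fun i _ => Int.natAbs_add_le _ _

lemma l1Norm_sub_le (u v w : Fin d → ℤ) : l1Norm (u - w) ≤ l1Norm (u - v) + l1Norm (v - w) := by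
  have := l1Norm_add_le (u - v) (v - w)
  simpa using this

lemma natAbs_le_l1Norm (u : Fin d → ℤ) (i : Fin d) : (u i).natAbs ≤ l1Norm u :=
  Finset.single_le_sum (f := fun i => (u i).natAbs) (fun _ _ => Nat.zero_le _) (Finset.mem_univ i)

lemma l1Norm_single (i : Fin d) (c : ℤ) : l1Norm (Pi.single i c) = c.natAbs := by
  rw [l1Norm, Finset.sum_eq_single i]
  · simp
  · intro j _ hj; simp [hj]
  · simp

lemma l1Norm_add_single (u : Fin d → ℤ) (i : Fin d) (c : ℤ) :
    l1Norm (u + Pi.single i c) + (u i).natAbs = l1Norm u + (u i + c).natAbs := by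
  rw [l1Norm, l1Norm, ← Finset.add_sum_erase _ _ (Finset.mem_univ i),
    ← Finset.add_sum_erase _ (fun j => (u j).natAbs) (Finset.mem_univ i)]
  have : ∑ x ∈ Finset.univ.erase i, ((u + Pi.single i c : Fin d → ℤ) x).natAbs =
      ∑ x ∈ Finset.univ.erase i, (u x).natAbs :=
    Finset.sum_congr rfl fun j hj => by
      simp [(Finset.mem_erase.1 hj).1]
  rw [this]
  simp
  ring

lemma lattice_adj {u v : Fin d → ℤ} : (lattice d).Adj u v ↔ l1Norm (u - v) = 1 := Iff.rfl

/-- Two vertices are joined by a path whose length is their distance. -/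
lemma exists_walk_length_eq (u v : Fin d → ℤ) :
    ∃ α : (lattice d).Walk u v, α.length = l1Norm (u - v) := by
  induction h : l1Norm (u - v) generalizing u with
  | zero =>
    have huv : u = v := by
      ext i
      have := natAbs_le_l1Norm (u - v) i
      rw [h] at this
      simp only [Pi.sub_apply] at this
      omega
    subst huv
    exact ⟨.nil, rfl⟩
  | succ n ih =>
    obtain ⟨i, hi⟩ : ∃ i, u i - v i ≠ 0 := by
      by_contra! hc
      have : u - v = 0 := funext hc
      rw [this, l1Norm_zero] at h
      omega
    obtain ⟨c, hc1, hc2⟩ : ∃ c : ℤ, c.natAbs = 1 ∧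
        (u i - v i + c).natAbs + 1 = (u i - v i).natAbs := by
      rcases lt_or_gt_of_ne hi with h0 | h0
      · exact ⟨1, rfl, by omega⟩
      · exact ⟨-1, rfl, by omega⟩
    have hadj : (lattice d).Adj u (u + Pi.single i c) := by
      rw [lattice_adj, sub_add_cancel_left, l1Norm_neg, l1Norm_single, hc1]
    have hn := l1Norm_add_single (u - v) i c
    rw [Pi.sub_apply, h] at hn
    obtain ⟨α, hα⟩ := ih (u + Pi.single i c) (by
      rw [add_sub_right_comm]; omega)
    exact ⟨.cons hadj α, by simp [hα]⟩

lemma l1Norm_sub_le_of_mem_support {u v w : Fin d → ℤ} (α : (lattice d).Walk u v)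
    (hw : w ∈ α.support) : l1Norm (w - u) ≤ α.length := by
  induction α with
  | nil => simp at hw; simp [hw, l1Norm_zero]
  | @cons u u' v h q ih =>
    rw [SimpleGraph.Walk.support_cons, List.mem_cons] at hw
    rcases hw with rfl | hw
    · simp [l1Norm_zero]
    · have h1 := ih hw
      have h2 := l1Norm_sub_le w u' u
      have h3 : l1Norm (u' - u) = 1 := by rw [l1Norm_sub_comm]; exact h
      rw [SimpleGraph.Walk.length_cons]
      omega

end Lattice

section Split

variable {V : Type*} {G : SimpleGraph V}

/-- A walk can be cut at its first visit to a set. -/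
lemma exists_append_first {u v : V} (α : G.Walk u v) (P : Set V) (h : ∃ w ∈ α.support, w ∈ P) :
    ∃ (s : V) (β : G.Walk u s) (γ : G.Walk s v), s ∈ P ∧ α = β.append γ ∧
      ∀ e ∈ β.darts, e.fst ∉ P := by
  induction α with
  | @nil u =>
    obtain ⟨w, hw, hP⟩ := h
    have : w = u := by simpa using hw
    exact ⟨u, .nil, .nil, this ▸ hP, rfl, by simp⟩
  | @cons u u' v hadj q ih =>
    by_cases hu : u ∈ P
    · exact ⟨u, .nil, .cons hadj q, hu, rfl, by simp⟩
    · obtain ⟨s, β, γ, hs, hq, hβ⟩ := ih (by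
        obtain ⟨w, hw, hP⟩ := h
        rw [SimpleGraph.Walk.support_cons, List.mem_cons] at hw
        rcases hw with rfl | hw
        · exact absurd hP hu
        · exact ⟨w, hw, hP⟩)
      refine ⟨s, .cons hadj β, γ, hs, by rw [hq]; rfl, ?_⟩
      intro e he
      rw [SimpleGraph.Walk.darts_cons, List.mem_cons] at he
      rcases he with rfl | he
      · exact hu
      · exact hβ e he

/-- A walk can be cut at its last visit to a set. -/
lemma exists_append_last {u v : V} (α : G.Walk u v) (P : Set V) (h : ∃ w ∈ α.support, w ∈ P) :
    ∃ (t : V) (β : G.Walk u t) (γ : G.Walk t v), t ∈ P ∧ α = β.append γ ∧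
      ∀ e ∈ γ.darts, e.snd ∉ P := by
  obtain ⟨t, β, γ, ht, hα, hβ⟩ := exists_append_first α.reverse P (by simpa using h)
  refine ⟨t, γ.reverse, β.reverse, ht, ?_, ?_⟩
  · rw [← SimpleGraph.Walk.reverse_append, ← hα, SimpleGraph.Walk.reverse_reverse]
  · intro e he
    rw [SimpleGraph.Walk.darts_reverse, List.mem_reverse, List.mem_map] at he
    obtain ⟨e', he', rfl⟩ := he
    exact hβ e' he'

/-- A walk can be cut at its first and last visits to a set. -/
lemma exists_append_append {u v : V} (α : G.Walk u v) (P : Set V)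
    (h : ∃ w ∈ α.support, w ∈ P) :
    ∃ (s t : V) (β : G.Walk u s) (γ : G.Walk s t) (η : G.Walk t v), s ∈ P ∧ t ∈ P ∧
      α = β.append (γ.append η) ∧ (∀ e ∈ β.darts, e.fst ∉ P) ∧ ∀ e ∈ η.darts, e.snd ∉ P := by
  obtain ⟨s, β, γ, hs, hα, hβ⟩ := exists_append_first α P h
  obtain ⟨t, γ', η, ht, hγ, hη⟩ := exists_append_last γ P ⟨s, by simp, hs⟩
  exact ⟨s, t, β, γ', η, hs, ht, by rw [hα, hγ], hβ, hη⟩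

end Split

section PassageTime

variable {d : ℕ}

lemma pathTime_nil (x : Edge d → ℝ≥0) (u : Fin d → ℤ) :
    pathTime x (SimpleGraph.Walk.nil : (lattice d).Walk u u) = 0 := rfl

lemma pathTime_append (x : Edge d → ℝ≥0) {u v w : Fin d → ℤ} (α : (lattice d).Walk u v)
    (β : (lattice d).Walk v w) : pathTime x (α.append β) = pathTime x α + pathTime x β := by
  simp [pathTime]

lemma pathTime_congr {x y : Edge d → ℝ≥0} {u v : Fin d → ℤ} (α : (lattice d).Walk u v)
    (h : ∀ e ∈ α.darts, x ⟨e.edge, e.edge_mem⟩ = y ⟨e.edge, e.edge_mem⟩) :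
    pathTime x α = pathTime y α := by
  rw [pathTime, pathTime, List.map_congr_left h]

lemma pathTime_mono {x y : Edge d → ℝ≥0} (h : ∀ e, x e ≤ y e) {u v : Fin d → ℤ}
    (α : (lattice d).Walk u v) : pathTime x α ≤ pathTime y α :=
  List.sum_le_sum fun _ _ => h _

lemma pathTime_le {b : ℝ≥0} {x : Edge d → ℝ≥0} (hb : ∀ e, x e ≤ b) {u v : Fin d → ℤ}
    (α : (lattice d).Walk u v) : (pathTime x α : ℝ) ≤ b * α.length := by
  have := pathTime_mono hb α
  have e : pathTime (fun _ => b) α = α.length * b := by simp [pathTime]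
  rw [e] at this
  rw [mul_comm]
  exact_mod_cast this

lemma le_pathTime {a : ℝ≥0} {x : Edge d → ℝ≥0} (ha : ∀ e, a ≤ x e) {u v : Fin d → ℤ}
    (α : (lattice d).Walk u v) : a * α.length ≤ (pathTime x α : ℝ) := by
  have := pathTime_mono ha α
  have e : pathTime (fun _ => a) α = α.length * a := by simp [pathTime]
  rw [e] at this
  rw [mul_comm]
  exact_mod_cast this

lemma bddBelow_pathTime (x : Edge d → ℝ≥0) (u v : Fin d → ℤ) :
    BddBelow (Set.range fun α : (lattice d).Walk u v => (pathTime x α : ℝ)) :=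
  ⟨0, by rintro _ ⟨α, rfl⟩; exact NNReal.coe_nonneg _⟩

lemma passageTime_le_pathTime (x : Edge d → ℝ≥0) {u v : Fin d → ℤ} (α : (lattice d).Walk u v) :
    passageTime x u v ≤ pathTime x α :=
  ciInf_le (bddBelow_pathTime x u v) α

instance (u v : Fin d → ℤ) : Nonempty ((lattice d).Walk u v) :=
  let ⟨α, _⟩ := exists_walk_length_eq u v
  ⟨α⟩

lemma passageTime_nonneg (x : Edge d → ℝ≥0) (u v : Fin d → ℤ) : 0 ≤ passageTime x u v :=
  le_ciInf fun _ => NNReal.coe_nonneg _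

lemma passageTime_mono {x y : Edge d → ℝ≥0} (h : ∀ e, x e ≤ y e) (u v : Fin d → ℤ) :
    passageTime x u v ≤ passageTime y u v :=
  ciInf_mono (bddBelow_pathTime x u v) fun α => NNReal.coe_le_coe.2 (pathTime_mono h α)

lemma passageTime_le {b : ℝ≥0} {x : Edge d → ℝ≥0} (hb : ∀ e, x e ≤ b) (u v : Fin d → ℤ) :
    passageTime x u v ≤ b * l1Norm (u - v) := by
  obtain ⟨α, hα⟩ := exists_walk_length_eq u v
  rw [← hα]
  exact (passageTime_le_pathTime x α).trans (pathTime_le hb α)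

lemma passageTime_triangle (x : Edge d → ℝ≥0) (u v w : Fin d → ℤ) :
    passageTime x u w ≤ passageTime x u v + passageTime x v w := by
  refine le_ciInf_add_ciInf fun α β => ?_
  have := passageTime_le_pathTime x (α.append β)
  rw [pathTime_append] at this
  exact_mod_cast this

instance countable_walk (u v : Fin d → ℤ) : Countable ((lattice d).Walk u v) :=
  Function.Injective.countable (f := fun α : (lattice d).Walk u v => α.support)
    fun _ _ h => SimpleGraph.Walk.ext_support h

lemma measurable_pathTime {u v : Fin d → ℤ} (α : (lattice d).Walk u v) :
    Measurable fun x : Edge d → ℝ≥0 => pathTime x α := by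
  induction α with
  | nil => exact measurable_const
  | cons h q ih =>
    exact (measurable_pi_apply _).add ih

lemma measurable_passageTime (u v : Fin d → ℤ) :
    Measurable fun x : Edge d → ℝ≥0 => passageTime x u v :=
  Measurable.iInf fun α => (measurable_pathTime α).coe_nnreal_real

/-- Passage times cannot be improved by replacing a piece of an optimal path. -/
lemma pathTime_le_of_optimal {x : Edge d → ℝ≥0} {u s t v : Fin d → ℤ} {β : (lattice d).Walk u s}
    {γ : (lattice d).Walk s t} {η : (lattice d).Walk t v}
    (h : (pathTime x (β.append (γ.append η)) : ℝ) = passageTime x u v) :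
    (pathTime x γ : ℝ) ≤ passageTime x s t := by
  refine le_ciInf fun γ' => ?_
  have h1 := passageTime_le_pathTime x (β.append (γ'.append η))
  rw [← h] at h1
  simp only [pathTime_append, NNReal.coe_add] at h1
  linarith

end PassageTime

section TwoValues

open Function

variable {d : ℕ} {a b : ℝ≥0}

/-- The edge weights with the value `b` on the edges marked `true` and `a` on the others. -/
def weights (a b : ℝ≥0) (x : Edge d → Bool) : Edge d → ℝ≥0 := fun e => if x e then b else a

/-- The passage time as a function on the cube. -/
noncomputable def cubeTime (a b : ℝ≥0) (u v : Fin d → ℤ) (x : Edge d → Bool) : ℝ :=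
  passageTime (weights a b x) u v

lemma weights_le (hab : a ≤ b) (x : Edge d → Bool) (e : Edge d) : weights a b x e ≤ b := by
  unfold weights; split_ifs <;> simp [hab]

lemma le_weights (hab : a ≤ b) (x : Edge d → Bool) (e : Edge d) : a ≤ weights a b x e := by
  unfold weights; split_ifs <;> simp [hab]

lemma weights_update_of_ne (x : Edge d → Bool) {e e' : Edge d} (c : Bool) (h : e' ≠ e) :
    weights a b (update x e c) e' = weights a b x e' := by
  simp [weights, update_of_ne h]

lemma exists_pathTime_eq (x : Edge d → Bool) {u v : Fin d → ℤ} (α : (lattice d).Walk u v) :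
    ∃ i j : ℕ, i + j = α.length ∧ (pathTime (weights a b x) α : ℝ) = i * a + j * b := by
  induction α with
  | nil => exact ⟨0, 0, by simp [pathTime_nil]⟩
  | cons h q ih =>
    obtain ⟨i, j, hij, hq⟩ := ih
    have e : (pathTime (weights a b x) (SimpleGraph.Walk.cons h q) : ℝ) =
        (weights a b x ⟨s(_, _), h⟩ : ℝ) + pathTime (weights a b x) q := rfl
    rw [e, hq]
    by_cases hx : x ⟨s(_, _), h⟩
    · refine ⟨i, j + 1, by simp [← hij]; ring, ?_⟩
      simp only [weights, hx, if_true]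
      push_cast; ring
    · refine ⟨i + 1, j, by simp [← hij]; ring, ?_⟩
      simp only [weights, hx]
      push_cast; ring

/-- The infimum in the definition of the passage time is attained. -/
lemma exists_pathTime_eq_passageTime (ha : 0 < a) (hab : a ≤ b) (x : Edge d → Bool)
    (u v : Fin d → ℤ) :
    ∃ α : (lattice d).Walk u v, (pathTime (weights a b x) α : ℝ) = cubeTime a b u v x := by
  obtain ⟨α₀⟩ : Nonempty ((lattice d).Walk u v) := inferInstance
  set c : ℝ := (pathTime (weights a b x) α₀ : ℝ) with hc
  have ha' : (0 : ℝ) < a := ha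
  obtain ⟨N, hN⟩ := exists_nat_ge (c / a)
  rw [div_le_iff₀ ha'] at hN
  set s : Set ℝ := (Set.range fun α : (lattice d).Walk u v =>
    (pathTime (weights a b x) α : ℝ)) ∩ Set.Iic c with hs
  have hfin : s.Finite := by
    refine ((Set.finite_Iic N).image2 (fun i j : ℕ => (i * a + j * b : ℝ))
      (Set.finite_Iic N)).subset ?_
    rintro _ ⟨⟨α, rfl⟩, hα⟩
    have hα' : (pathTime (weights a b x) α : ℝ) ≤ c := hα
    obtain ⟨i, j, hij, he⟩ := exists_pathTime_eq (a := a) (b := b) x α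
    have h1 := le_pathTime (le_weights hab x) α
    have h2 : (α.length : ℝ) ≤ N := by
      have : (a : ℝ) * α.length ≤ a * N := by linarith
      exact le_of_mul_le_mul_left this ha'
    have h3 : α.length ≤ N := by exact_mod_cast h2
    exact ⟨i, by simp; omega, j, by simp; omega, he.symm⟩
  obtain ⟨_, ⟨⟨α, rfl⟩, hα⟩, hmin⟩ := Set.exists_min_image s id hfin ⟨c, ⟨α₀, rfl⟩, Set.mem_Iic.2 le_rfl⟩
  refine ⟨α, le_antisymm (le_ciInf fun β => ?_) (passageTime_le_pathTime _ α)⟩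
  have hα' : (pathTime (weights a b x) α : ℝ) ≤ c := hα
  by_cases hβ : (pathTime (weights a b x) β : ℝ) ≤ c
  · exact hmin _ ⟨⟨β, rfl⟩, hβ⟩
  · linarith

lemma cubeTime_le (hab : a ≤ b) (u v : Fin d → ℤ) (x : Edge d → Bool) :
    cubeTime a b u v x ≤ b * l1Norm (u - v) :=
  passageTime_le (weights_le hab x) u v

lemma mem_support_of_mem_of_mem_edges {V : Type*} {G : SimpleGraph V} {u v w : V}
    {α : G.Walk u v} {e : Sym2 V} (he : e ∈ α.edges) (hw : w ∈ e) : w ∈ α.support := by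
  obtain ⟨y, rfl⟩ := Sym2.mem_iff_exists.1 hw
  exact α.fst_mem_support_of_mem_edges he

lemma pathTime_update_of_notMem (x : Edge d → Bool) {e : Edge d} (c : Bool)
    {u v : Fin d → ℤ} {α : (lattice d).Walk u v} (h : e.1 ∉ α.edges) :
    pathTime (weights a b (update x e c)) α = pathTime (weights a b x) α := by
  refine pathTime_congr α fun f hf => weights_update_of_ne x c fun hfe => h ?_
  rw [← hfe]
  exact List.mem_map_of_mem hf

/-- The passage time depends on finitely many edges. -/
lemma exists_dependsOn_cubeTime (ha : 0 < a) (hab : a ≤ b) (u v : Fin d → ℤ) :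
    ∃ s : Finset (Edge d), DependsOn (cubeTime a b u v) (s : Set (Edge d)) := by
  classical
  have ha' : (0 : ℝ) < a := ha
  obtain ⟨N, hN⟩ := exists_nat_ge ((b * l1Norm (u - v) : ℝ) / a)
  rw [div_le_iff₀ ha'] at hN
  set A : Finset (Fin d → ℤ) := Finset.Icc (u - fun _ => (N : ℤ)) (u + fun _ => (N : ℤ)) with hA
  set s : Finset (Edge d) := A.sym2.subtype (· ∈ (lattice d).edgeSet) with hs
  have key : ∀ x y : Edge d → Bool, (∀ e ∈ s, x e = y e) →
      cubeTime a b u v y ≤ cubeTime a b u v x := by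
    intro x y hxy
    obtain ⟨α, hα⟩ := exists_pathTime_eq_passageTime ha hab x u v
    have h1 := le_pathTime (le_weights hab x) α
    have h2 : (α.length : ℝ) ≤ N := by
      have h3 := cubeTime_le hab u v x
      have : (a : ℝ) * α.length ≤ a * N := by linarith
      exact le_of_mul_le_mul_left this ha'
    have h3 : α.length ≤ N := by exact_mod_cast h2
    have hsup : ∀ w ∈ α.support, w ∈ A := by
      intro w hw
      have h4 := l1Norm_sub_le_of_mem_support α hw
      rw [hA, Finset.mem_Icc]
      constructor <;> intro i <;> have := natAbs_le_l1Norm (w - u) i <;>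
        simp only [Pi.sub_apply, Pi.add_apply] at this ⊢ <;> omega
    rw [← hα]
    have : pathTime (weights a b x) α = pathTime (weights a b y) α := by
      refine pathTime_congr α fun e he => ?_
      have hes : (⟨e.edge, e.edge_mem⟩ : Edge d) ∈ s := by
        rw [hs, Finset.mem_subtype, Finset.mem_sym2_iff]
        intro w hw
        exact hsup w (mem_support_of_mem_of_mem_edges (List.mem_map_of_mem he) hw)
      simp only [weights, hxy _ hes]
    rw [this]
    exact passageTime_le_pathTime _ α
  exact ⟨s, fun x y h => le_antisymm (key y x fun e he => (h e he).symm) (key x y h)⟩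

lemma discDeriv_cubeTime_nonneg (hab : a ≤ b) (u v : Fin d → ℤ) (e : Edge d)
    (x : Edge d → Bool) : 0 ≤ discDeriv e (cubeTime a b u v) x := by
  refine sub_nonneg.2 (passageTime_mono (fun f => ?_) u v)
  by_cases h : f = e
  · subst h; simp [weights, hab]
  · rw [weights_update_of_ne x _ h, weights_update_of_ne x _ h]

lemma discDeriv_cubeTime_nonpos_of_notMem {u v : Fin d → ℤ} {e : Edge d} {x : Edge d → Bool}
    {α : (lattice d).Walk u v} (he : e.1 ∉ α.edges)
    (hα : (pathTime (weights a b (update x e false)) α : ℝ) =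
      cubeTime a b u v (update x e false)) :
    discDeriv e (cubeTime a b u v) x ≤ 0 := by
  have h1 : cubeTime a b u v (update x e true) ≤ pathTime (weights a b (update x e true)) α :=
    passageTime_le_pathTime _ α
  rw [pathTime_update_of_notMem x _ he] at h1 hα
  rw [discDeriv]
  linarith

lemma notMem_edges_of_forall_fst {V : Type*} {G : SimpleGraph V} {u v : V} {α : G.Walk u v}
    {e : Sym2 V} {P : Set V} (hP : ∀ w ∈ e, w ∈ P) (h : ∀ f ∈ α.darts, f.fst ∉ P) :
    e ∉ α.edges := by
  intro he
  obtain ⟨f, hf, rfl⟩ := List.mem_map.1 he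
  exact h f hf (hP _ (Sym2.mem_mk_left _ _))

lemma notMem_edges_of_forall_snd {V : Type*} {G : SimpleGraph V} {u v : V} {α : G.Walk u v}
    {e : Sym2 V} {P : Set V} (hP : ∀ w ∈ e, w ∈ P) (h : ∀ f ∈ α.darts, f.snd ∉ P) :
    e ∉ α.edges := by
  intro he
  obtain ⟨f, hf, rfl⟩ := List.mem_map.1 he
  exact h f hf (hP _ (Sym2.mem_mk_right _ _))

lemma l1Norm_sub_le_one_of_mem {e : Edge d} {s t : Fin d → ℤ} (hs : s ∈ e.1) (ht : t ∈ e.1) :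
    l1Norm (s - t) ≤ 1 := by
  obtain ⟨e, he⟩ := e
  obtain ⟨y, rfl⟩ := Sym2.mem_iff_exists.1 hs
  have hsy : l1Norm (s - y) = 1 := he
  rcases Sym2.mem_iff.1 ht with rfl | rfl
  · simp [l1Norm_zero]
  · exact hsy.le

lemma discDeriv_cubeTime_le (ha : 0 < a) (hab : a ≤ b) (u v : Fin d → ℤ) (e : Edge d)
    (x : Edge d → Bool) : discDeriv e (cubeTime a b u v) x ≤ b := by
  obtain ⟨α, hα⟩ := exists_pathTime_eq_passageTime ha hab (update x e false) u v
  by_cases he : e.1 ∈ α.edges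
  · obtain ⟨f, hf, hfe⟩ := List.mem_map.1 he
    obtain ⟨s, t, β, γ, η, hs, ht, rfl, hβ, hη⟩ := exists_append_append α {w | w ∈ e.1}
      ⟨f.fst, α.dart_fst_mem_support_of_mem_darts hf, by
        rw [← hfe]; exact Sym2.mem_mk_left _ _⟩
    have heβ : e.1 ∉ β.edges := notMem_edges_of_forall_fst (fun _ h => h) hβ
    have heη : e.1 ∉ η.edges := notMem_edges_of_forall_snd (fun _ h => h) hη
    have h1 : cubeTime a b u v (update x e true) ≤ _ :=
      (passageTime_triangle _ u s v).trans
        (add_le_add_right (passageTime_triangle _ s t v) _)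
    have h2 := passageTime_le_pathTime (weights a b (update x e true)) β
    have h3 := passageTime_le_pathTime (weights a b (update x e true)) η
    have h4 := passageTime_le (weights_le hab (update x e true)) s t
    have h5 : (b : ℝ) * l1Norm (s - t) ≤ b :=
      mul_le_of_le_one_right b.2 (by exact_mod_cast l1Norm_sub_le_one_of_mem hs ht)
    rw [pathTime_append, pathTime_append] at hα
    rw [pathTime_update_of_notMem x _ heβ] at h2 hα
    rw [pathTime_update_of_notMem x _ heη] at h3 hα
    push_cast at hα
    have h6 := (pathTime (weights a b (update x e false)) γ).2
    have h7 : (0 : ℝ) ≤ pathTime (weights a b (update x e false)) γ := h6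
    rw [discDeriv]
    linarith
  · exact (discDeriv_cubeTime_nonpos_of_notMem he hα).trans b.2

lemma sum_discDeriv_cubeTime_le_length (ha : 0 < a) (hab : a ≤ b) {u v : Fin d → ℤ}
    {x : Edge d → Bool} {α : (lattice d).Walk u v}
    (hα : (pathTime (weights a b x) α : ℝ) = cubeTime a b u v x) (Z : Finset (Edge d))
    {L : List (Sym2 (Fin d → ℤ))} (hL : ∀ e ∈ Z, e.1 ∈ α.edges → e.1 ∈ L) :
    ∑ e ∈ Z, (if x e = false then discDeriv e (cubeTime a b u v) x else 0) ≤ b * L.length := by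
  calc ∑ e ∈ Z, (if x e = false then discDeriv e (cubeTime a b u v) x else 0)
      ≤ ∑ e ∈ Z, (if e.1 ∈ L then (b : ℝ) else 0) := by
        refine Finset.sum_le_sum fun e he => ?_
        by_cases hx : x e = false
        · rw [if_pos hx]
          split_ifs with heL
          · exact discDeriv_cubeTime_le ha hab u v e x
          · have hup : update x e false = x := by rw [← hx, update_eq_self]
            exact discDeriv_cubeTime_nonpos_of_notMem (fun h => heL (hL e he h))
              (by rw [hup]; exact hα)
        · rw [if_neg hx]
          split_ifs
          · exact b.2
          · exact le_rfl
    _ = b * (Z.filter fun e => e.1 ∈ L).card := by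
        rw [← Finset.sum_filter, Finset.sum_const, nsmul_eq_mul, mul_comm]
    _ ≤ b * L.length := by
        have : (Z.filter fun e => e.1 ∈ L).card ≤ L.toFinset.card :=
          Finset.card_le_card_of_injOn Subtype.val (fun e he => by
            simpa using (Finset.mem_filter.1 he).2) Subtype.val_injective.injOn
        have h2 := this.trans L.toFinset_card_le
        have h3 : ((Z.filter fun e => e.1 ∈ L).card : ℝ) ≤ L.length := by exact_mod_cast h2
        exact mul_le_mul_of_nonneg_left h3 b.2

lemma sum_discDeriv_cubeTime_le (ha : 0 < a) (hab : a ≤ b) (u v : Fin d → ℤ)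
    (x : Edge d → Bool) (Z : Finset (Edge d)) :
    ∑ e ∈ Z, (if x e = false then discDeriv e (cubeTime a b u v) x else 0) ≤
      b ^ 2 / a * l1Norm (u - v) := by
  have ha' : (0 : ℝ) < a := ha
  obtain ⟨α, hα⟩ := exists_pathTime_eq_passageTime ha hab x u v
  refine (sum_discDeriv_cubeTime_le_length ha hab hα Z (L := α.edges) fun _ _ h => h).trans ?_
  rw [SimpleGraph.Walk.length_edges]
  have h1 := le_pathTime (le_weights hab x) α
  have h2 := cubeTime_le hab u v x
  have h3 : (α.length : ℝ) ≤ b * l1Norm (u - v) / a := by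
    rw [le_div_iff₀ ha']; linarith
  calc (b : ℝ) * α.length ≤ b * (b * l1Norm (u - v) / a) := mul_le_mul_of_nonneg_left h3 b.2
    _ = _ := by ring

/-- An optimal path spends little time in a set of small diameter. -/
lemma sum_discDeriv_cubeTime_le_of_diam (ha : 0 < a) (hab : a ≤ b) (u v : Fin d → ℤ)
    (x : Edge d → Bool) (Z : Finset (Edge d)) {P : Set (Fin d → ℤ)} {R : ℕ}
    (hZ : ∀ e ∈ Z, ∀ w ∈ e.1, w ∈ P) (hP : ∀ s ∈ P, ∀ t ∈ P, l1Norm (s - t) ≤ R) :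
    ∑ e ∈ Z, (if x e = false then discDeriv e (cubeTime a b u v) x else 0) ≤
      b ^ 2 / a * R := by
  have ha' : (0 : ℝ) < a := ha
  obtain ⟨α, hα⟩ := exists_pathTime_eq_passageTime ha hab x u v
  by_cases hex : ∃ w ∈ α.support, w ∈ P
  · obtain ⟨s, t, β, γ, η, hs, ht, rfl, hβ, hη⟩ := exists_append_append α P hex
    refine (sum_discDeriv_cubeTime_le_length ha hab hα Z (L := γ.edges) fun e he h => ?_).trans ?_
    · rw [SimpleGraph.Walk.edges_append, SimpleGraph.Walk.edges_append, List.mem_append,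
        List.mem_append] at h
      rcases h with h | h | h
      · exact absurd h (notMem_edges_of_forall_fst (hZ e he) hβ)
      · exact h
      · exact absurd h (notMem_edges_of_forall_snd (hZ e he) hη)
    · rw [SimpleGraph.Walk.length_edges]
      have h1 := le_pathTime (le_weights hab x) γ
      have h2 := pathTime_le_of_optimal hα
      have h3 := passageTime_le (weights_le hab x) s t
      have h4 : (l1Norm (s - t) : ℝ) ≤ R := by exact_mod_cast hP s hs t ht
      have h5 := mul_le_mul_of_nonneg_left h4 b.2
      have h6 : (γ.length : ℝ) ≤ b * R / a := by
        rw [le_div_iff₀ ha']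
        calc (γ.length : ℝ) * a = a * γ.length := mul_comm _ _
          _ ≤ b * l1Norm (s - t) := h1.trans (h2.trans h3)
          _ ≤ b * R := h5
      calc (b : ℝ) * γ.length ≤ b * (b * R / a) := mul_le_mul_of_nonneg_left h6 b.2
        _ = _ := by ring
  · refine (sum_discDeriv_cubeTime_le_length ha hab hα Z (L := []) fun e he h => ?_).trans ?_
    · obtain ⟨f, hf, hfe⟩ := List.mem_map.1 h
      exact absurd ⟨f.fst, α.dart_fst_mem_support_of_mem_darts hf, hZ e he _ (by
        rw [← hfe]; exact Sym2.mem_mk_left _ _)⟩ hex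
    · simp only [List.length_nil, Nat.cast_zero, mul_zero]
      positivity

end TwoValues

section Translation

open Function

variable {d : ℕ} {a b : ℝ≥0}

/-- The translation by `z` as an automorphism of the lattice. -/
def translation (z : Fin d → ℤ) : lattice d ≃g lattice d where
  toEquiv := Equiv.addRight z
  map_rel_iff' := by simp [lattice_adj]

/-- The translation by `z` of the edges of the lattice. -/
def edgeShift (z : Fin d → ℤ) : Edge d ≃ Edge d := (translation z).mapEdgeSet

lemma edgeShift_val (z : Fin d → ℤ) (e : Edge d) : (edgeShift z e).1 = Sym2.map (· + z) e.1 := rfl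

lemma pathTime_map_translation (y : Edge d → ℝ≥0) (z : Fin d → ℤ) {u v : Fin d → ℤ}
    (α : (lattice d).Walk u v) :
    pathTime y (α.map (translation z).toHom) = pathTime (fun e => y (edgeShift z e)) α := by
  induction α with
  | nil => rfl
  | cons h q ih =>
    have h1 : ∀ (y : Edge d → ℝ≥0) {u v w : Fin d → ℤ} (h : (lattice d).Adj u v)
      (q : (lattice d).Walk v w), pathTime y (.cons h q) = y ⟨s(u, v), h⟩ + pathTime y q :=
      fun _ _ _ _ _ _ => rfl
    rw [h1, SimpleGraph.Walk.map_cons, h1, ih]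
    rfl

lemma passageTime_add_le (y : Edge d → ℝ≥0) (z u v : Fin d → ℤ) :
    passageTime y (u + z) (v + z) ≤ passageTime (fun e => y (edgeShift z e)) u v := by
  refine le_ciInf fun α => ?_
  rw [← pathTime_map_translation]
  exact passageTime_le_pathTime y _

lemma edgeShift_edgeShift_neg (z : Fin d → ℤ) (e : Edge d) :
    edgeShift z (edgeShift (-z) e) = e := by
  apply Subtype.ext
  rw [edgeShift_val, edgeShift_val, Sym2.map_map]
  simp

lemma passageTime_add (y : Edge d → ℝ≥0) (z u v : Fin d → ℤ) :
    passageTime y (u + z) (v + z) = passageTime (fun e => y (edgeShift z e)) u v := by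
  refine le_antisymm (passageTime_add_le y z u v) ?_
  have := passageTime_add_le (fun e => y (edgeShift z e)) (-z) (u + z) (v + z)
  simpa [edgeShift_edgeShift_neg] using this

lemma cubeTime_add (z v : Fin d → ℤ) :
    cubeTime a b z (z + v) = fun x : Edge d → Bool =>
      cubeTime a b 0 v (fun e => x (edgeShift z e)) := by
  ext x
  have := passageTime_add (weights a b x) z 0 v
  rw [zero_add, add_comm v z] at this
  exact this

lemma discDeriv_comp_equiv {ι : Type*} [DecidableEq ι] (σ : ι ≃ ι) (e : ι)
    (g : (ι → Bool) → ℝ) (x : ι → Bool) :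
    discDeriv e (fun x => g fun i => x (σ i)) x = discDeriv (σ.symm e) g fun i => x (σ i) := by
  have : ∀ c, (fun i => update x e c (σ i)) = update (fun i => x (σ i)) (σ.symm e) c := by
    intro c
    ext i
    by_cases h : σ i = e
    · have hi : i = σ.symm e := by rw [← h]; simp
      rw [hi]; simp
    · have hi : i ≠ σ.symm e := fun hi => h (by rw [hi]; simp)
      rw [update_of_ne h, update_of_ne hi]
  simp only [discDeriv, this]

lemma dependsOn_ite_discDeriv {ι : Type*} [DecidableEq ι] (e : ι) {g : (ι → Bool) → ℝ}
    {s : Finset ι} (hg : DependsOn g (s : Set ι)) :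
    DependsOn (fun x => if x e = false then discDeriv e g x else 0)
      ((insert e s : Finset ι) : Set ι) := by
  intro x y h
  have h1 := h e (by simp)
  have h2 := dependsOn_discDeriv e hg (fun i hi => h i (by
    rw [Finset.coe_insert]; exact Set.mem_insert_of_mem _ hi))
  simp only [h1, h2]

lemma integral_ite_discDeriv {ι : Type*} [DecidableEq ι] (p : unitInterval) (e : ι)
    {g : (ι → Bool) → ℝ} {s : Finset ι} (hg : DependsOn g (s : Set ι)) :
    ∫ x, (if x e = false then discDeriv e g x else 0) ∂(cubeMeasure ι p) =
      (1 - p) * ∫ x, discDeriv e g x ∂(cubeMeasure ι p) := by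
  rw [← integral_resample p e (dependsOn_ite_discDeriv e hg), ← integral_const_mul]
  refine integral_congr_ae (Filter.Eventually.of_forall fun x => ?_)
  simp [resample_apply, discDeriv_update_self]

lemma mem_edgeShift_symm {z w : Fin d → ℤ} {e : Edge d} (hw : w ∈ ((edgeShift z).symm e).1) :
    w + z ∈ e.1 := by
  have h : (edgeShift z ((edgeShift z).symm e)).1 = e.1 := by rw [Equiv.apply_symm_apply]
  rw [← h, edgeShift_val]
  exact Sym2.mem_map.2 ⟨w, hw, rfl⟩

lemma edgeShift_symm_injective (e : Edge d) :
    Function.Injective fun z : Fin d → ℤ => (edgeShift z).symm e := by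
  intro z z' h
  simp only at h
  have h1 : edgeShift z ((edgeShift z).symm e) = edgeShift z' ((edgeShift z).symm e) := by
    rw [Equiv.apply_symm_apply, h, Equiv.apply_symm_apply]
  generalize (edgeShift z).symm e = e' at h1
  have h2 := congrArg Subtype.val h1
  rw [edgeShift_val, edgeShift_val] at h2
  obtain ⟨e', he'⟩ := e'
  induction e' with
  | _ u w =>
    simp only [Sym2.map_mk, Sym2.eq_iff] at h2
    rcases h2 with h2 | h2
    · exact add_left_cancel h2.1
    · ext i
      have e1 := congrFun h2.1 i
      have e2 := congrFun h2.2 i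
      simp only [Pi.add_apply] at e1 e2
      omega

/-- The box `[0, m)^d`. -/
noncomputable def box (d m : ℕ) : Finset (Fin d → ℤ) := Fintype.piFinset fun _ => Finset.Ico 0 (m : ℤ)

lemma card_box (d m : ℕ) : (box d m).card = m ^ d := by
  simp [box]

lemma l1Norm_le_of_mem_box {m : ℕ} {z : Fin d → ℤ} (hz : z ∈ box d m) : l1Norm z ≤ d * m := by
  have : ∀ i ∈ Finset.univ, (z i).natAbs ≤ m := fun i _ => by
    have := Fintype.mem_piFinset.1 hz i
    rw [Finset.mem_Ico] at this
    omega
  simpa [l1Norm] using Finset.sum_le_card_nsmul _ _ _ this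

lemma l1Norm_sub_le_of_mem_box {m : ℕ} {z z' : Fin d → ℤ} (hz : z ∈ box d m)
    (hz' : z' ∈ box d m) : l1Norm (z - z') ≤ d * m := by
  have : ∀ i ∈ Finset.univ, ((z - z') i).natAbs ≤ m := fun i _ => by
    have h1 := Fintype.mem_piFinset.1 hz i
    have h2 := Fintype.mem_piFinset.1 hz' i
    rw [Finset.mem_Ico] at h1 h2
    rw [Pi.sub_apply]
    omega
  simpa [l1Norm] using Finset.sum_le_card_nsmul _ _ _ this

/-- The passage time averaged over the translates by the vectors of a box. -/
noncomputable def avgTime (a b : ℝ≥0) (m : ℕ) (v : Fin d → ℤ) (x : Edge d → Bool) : ℝ :=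
  ((m : ℝ) ^ d)⁻¹ * ∑ z ∈ box d m, cubeTime a b z (z + v) x

lemma exists_dependsOn_avgTime (ha : 0 < a) (hab : a ≤ b) (m : ℕ) (v : Fin d → ℤ) :
    ∃ s : Finset (Edge d), DependsOn (avgTime a b m v) (s : Set (Edge d)) := by
  choose s hs using fun z : Fin d → ℤ => exists_dependsOn_cubeTime (d := d) ha hab z (z + v)
  refine ⟨(box d m).biUnion s, fun x y h => ?_⟩
  rw [avgTime, avgTime]
  congr 1
  refine Finset.sum_congr rfl fun z hz => hs z fun e he => h e ?_
  exact Finset.mem_coe.2 (Finset.mem_biUnion.2 ⟨z, hz, he⟩)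

lemma discDeriv_avgTime (m : ℕ) (v : Fin d → ℤ) (e : Edge d) (x : Edge d → Bool) :
    discDeriv e (avgTime a b m v) x =
      ((m : ℝ) ^ d)⁻¹ * ∑ z ∈ box d m, discDeriv e (cubeTime a b z (z + v)) x := by
  simp only [discDeriv, avgTime, Finset.sum_sub_distrib, mul_sub]

lemma avg_box_le {m : ℕ} (hm : 0 < m) {f : (Fin d → ℤ) → ℝ} {c : ℝ}
    (h : ∀ z ∈ box d m, f z ≤ c) : ((m : ℝ) ^ d)⁻¹ * ∑ z ∈ box d m, f z ≤ c := by
  have h1 := Finset.sum_le_card_nsmul _ _ _ h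
  rw [card_box, nsmul_eq_mul] at h1
  rw [inv_mul_le_iff₀ (by positivity)]
  exact_mod_cast h1

lemma discDeriv_avgTime_nonneg (hab : a ≤ b) (m : ℕ) (v : Fin d → ℤ) (e : Edge d)
    (x : Edge d → Bool) : 0 ≤ discDeriv e (avgTime a b m v) x := by
  rw [discDeriv_avgTime]
  exact mul_nonneg (by positivity)
    (Finset.sum_nonneg fun z _ => discDeriv_cubeTime_nonneg hab _ _ _ _)

lemma discDeriv_avgTime_le (ha : 0 < a) (hab : a ≤ b) {m : ℕ} (hm : 0 < m) (v : Fin d → ℤ)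
    (e : Edge d) (x : Edge d → Bool) : discDeriv e (avgTime a b m v) x ≤ b := by
  rw [discDeriv_avgTime]
  exact avg_box_le hm fun z _ => discDeriv_cubeTime_le ha hab _ _ _ _

lemma sum_discDeriv_avgTime_le (ha : 0 < a) (hab : a ≤ b) {m : ℕ} (hm : 0 < m)
    (v : Fin d → ℤ) (x : Edge d → Bool) (Z : Finset (Edge d)) :
    ∑ e ∈ Z, (if x e = false then discDeriv e (avgTime a b m v) x else 0) ≤
      b ^ 2 / a * l1Norm v := by
  have e1 : ∑ e ∈ Z, (if x e = false then discDeriv e (avgTime a b m v) x else 0) =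
      ((m : ℝ) ^ d)⁻¹ * ∑ z ∈ box d m, ∑ e ∈ Z,
        (if x e = false then discDeriv e (cubeTime a b z (z + v)) x else 0) := by
    rw [Finset.sum_comm, Finset.mul_sum]
    refine Finset.sum_congr rfl fun e _ => ?_
    split_ifs
    · exact discDeriv_avgTime m v e x
    · simp
  rw [e1]
  refine avg_box_le hm fun z _ => ?_
  have := sum_discDeriv_cubeTime_le ha hab z (z + v) x Z
  rwa [sub_add_cancel_left, l1Norm_neg] at this

lemma abs_avgTime_sub_le (hab : a ≤ b) {m : ℕ} (hm : 0 < m) (v : Fin d → ℤ)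
    (x : Edge d → Bool) :
    |avgTime a b m v x - cubeTime a b 0 v x| ≤ 2 * b * (d * m) := by
  have key : ∀ z ∈ box d m, cubeTime a b z (z + v) x - cubeTime a b 0 v x ≤ 2 * b * (d * m) ∧
      -(cubeTime a b z (z + v) x - cubeTime a b 0 v x) ≤ 2 * b * (d * m) := by
    intro z hz
    have hw := weights_le hab x
    have h0 : (l1Norm z : ℝ) ≤ d * m := by exact_mod_cast l1Norm_le_of_mem_box hz
    have h1 := mul_le_mul_of_nonneg_left h0 b.2
    have t1 := passageTime_triangle (weights a b x) z 0 (z + v)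
    have t2 := passageTime_triangle (weights a b x) 0 v (z + v)
    have t3 := passageTime_triangle (weights a b x) 0 z v
    have t4 := passageTime_triangle (weights a b x) z (z + v) v
    have l1 := passageTime_le hw z 0
    have l2 := passageTime_le hw v (z + v)
    have l3 := passageTime_le hw 0 z
    have l4 := passageTime_le hw (z + v) v
    rw [sub_zero] at l1
    rw [sub_add_cancel_right, l1Norm_neg] at l2
    rw [zero_sub, l1Norm_neg] at l3
    rw [add_sub_cancel_right] at l4
    simp only [cubeTime]
    constructor <;> simp only [NNReal.val_eq_coe] at h1 <;> linarith
  have e1 : avgTime a b m v x - cubeTime a b 0 v x = ((m : ℝ) ^ d)⁻¹ *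
      ∑ z ∈ box d m, (cubeTime a b z (z + v) x - cubeTime a b 0 v x) := by
    rw [Finset.sum_sub_distrib, Finset.sum_const, card_box, nsmul_eq_mul, mul_sub, avgTime]
    have : (m : ℝ) ^ d ≠ 0 := by positivity
    push_cast
    rw [inv_mul_cancel_left₀ this]
  rw [abs_le', e1]
  refine ⟨avg_box_le hm fun z hz => (key z hz).1, ?_⟩
  rw [← mul_neg, ← Finset.sum_neg_distrib]
  exact avg_box_le hm fun z hz => (key z hz).2

/-- Averaging makes the influences of the edges small. -/
lemma integral_discDeriv_avgTime_le (hd : 2 ≤ d) (ha : 0 < a) (hab : a ≤ b) {p : unitInterval}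
    (hp1 : (p : ℝ) < 1) {m : ℕ} (hm : 0 < m) (v : Fin d → ℤ) (e : Edge d) :
    ∫ x, discDeriv e (avgTime a b m v) x ∂(cubeMeasure (Edge d) p) ≤
      b ^ 2 / a * (1 + d) / (1 - p) / m := by
  have hq : 0 < 1 - (p : ℝ) := sub_pos.2 hp1
  obtain ⟨s, hs⟩ := exists_dependsOn_cubeTime (d := d) ha hab 0 v
  set f := cubeTime (d := d) a b 0 v with hf
  have e1 : ∀ z, ∫ x, discDeriv e (cubeTime a b z (z + v)) x ∂(cubeMeasure (Edge d) p) =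
      (1 - (p : ℝ))⁻¹ * ∫ x, (if x ((edgeShift z).symm e) = false then
        discDeriv ((edgeShift z).symm e) f x else 0) ∂(cubeMeasure (Edge d) p) := by
    intro z
    rw [integral_ite_discDeriv p _ hs, inv_mul_cancel_left₀ hq.ne', cubeTime_add]
    simp only [discDeriv_comp_equiv]
    exact integral_comp_cubeMeasure p (edgeShift z)
      (measurable_of_dependsOn (dependsOn_discDeriv ((edgeShift z).symm e) hs))
  have h_integrable : ∀ z, Integrable (discDeriv e (cubeTime a b z (z + v)))
      (cubeMeasure (Edge d) p) := fun z => by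
    obtain ⟨s', hs'⟩ := exists_dependsOn_cubeTime (d := d) ha hab z (z + v)
    exact integrable_of_dependsOn p (dependsOn_discDeriv e hs')
  have e2 : ∫ x, discDeriv e (avgTime a b m v) x ∂(cubeMeasure (Edge d) p) =
      ((m : ℝ) ^ d)⁻¹ * ((1 - (p : ℝ))⁻¹ * ∫ x, ∑ z ∈ box d m,
        (if x ((edgeShift z).symm e) = false then
          discDeriv ((edgeShift z).symm e) f x else 0) ∂(cubeMeasure (Edge d) p)) := by
    simp only [discDeriv_avgTime]
    rw [integral_const_mul, integral_finsetSum _ fun z _ => h_integrable z,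
      integral_finsetSum _ fun z _ => integrable_of_dependsOn p (dependsOn_ite_discDeriv _ hs),
      Finset.mul_sum _ _ (1 - (p : ℝ))⁻¹]
    simp only [e1]
  have hpt : ∀ x : Edge d → Bool, ∑ z ∈ box d m, (if x ((edgeShift z).symm e) = false then
      discDeriv ((edgeShift z).symm e) f x else 0) ≤ b ^ 2 / a * ((1 + d * m : ℕ) : ℝ) := by
    intro x
    have h1 := sum_discDeriv_cubeTime_le_of_diam ha hab 0 v x
      ((box d m).image fun z => (edgeShift z).symm e)
      (P := {w | ∃ z ∈ box d m, w + z ∈ e.1}) (R := 1 + d * m)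
      (by
        intro e' he' w hw
        obtain ⟨z, hz, rfl⟩ := Finset.mem_image.1 he'
        exact ⟨z, hz, mem_edgeShift_symm hw⟩)
      (by
        rintro w ⟨z, hz, hw⟩ w' ⟨z', hz', hw'⟩
        have h2 := l1Norm_sub_le_one_of_mem hw hw'
        have h3 := l1Norm_sub_le_of_mem_box hz' hz
        have h4 := l1Norm_add_le (w + z - (w' + z')) (z' - z)
        have h5 : w + z - (w' + z') + (z' - z) = w - w' := by abel
        rw [h5] at h4
        omega)
    rwa [Finset.sum_image (edgeShift_symm_injective e).injOn] at h1
  have h3 : ∫ x, ∑ z ∈ box d m, (if x ((edgeShift z).symm e) = false then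
      discDeriv ((edgeShift z).symm e) f x else 0) ∂(cubeMeasure (Edge d) p) ≤
      b ^ 2 / a * ((1 + d * m : ℕ) : ℝ) := by
    refine (integral_mono (integrable_finsetSum _ fun z _ =>
      integrable_of_dependsOn p (dependsOn_ite_discDeriv _ hs)) (integrable_const _) hpt).trans ?_
    simp
  have hm' : (1 : ℝ) ≤ m := by exact_mod_cast hm
  have h4 : ((1 + d * m : ℕ) : ℝ) ≤ (1 + d) * m := by
    push_cast; linarith
  have h5 : (m : ℝ) ^ 2 ≤ (m : ℝ) ^ d := pow_le_pow_right₀ hm' hd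
  rw [e2]
  have hm0 : (0 : ℝ) < m := by positivity
  calc ((m : ℝ) ^ d)⁻¹ * ((1 - (p : ℝ))⁻¹ * _)
      ≤ ((m : ℝ) ^ 2)⁻¹ * ((1 - (p : ℝ))⁻¹ * (b ^ 2 / a * ((1 + d) * m))) := by
        refine mul_le_mul (inv_anti₀ (by positivity) h5) ?_ ?_ (by positivity)
        · refine mul_le_mul_of_nonneg_left (h3.trans ?_) (inv_nonneg.2 hq.le)
          exact mul_le_mul_of_nonneg_left h4 (by positivity)
        · refine mul_nonneg (inv_nonneg.2 hq.le) (integral_nonneg fun x =>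
            Finset.sum_nonneg fun z _ => ?_)
          split_ifs
          · exact discDeriv_cubeTime_nonneg hab _ _ _ _
          · exact le_rfl
    _ = _ := by field_simp

end Translation

section Main

variable {d : ℕ} {a b : ℝ≥0}

lemma measurable_weights (a b : ℝ≥0) :
    Measurable (weights a b : (Edge d → Bool) → Edge d → ℝ≥0) :=
  measurable_pi_lambda _ fun e =>
    (measurable_of_finite fun c : Bool => if c then b else a).comp (measurable_pi_apply e)

lemma map_weights_cubeMeasure (d : ℕ) (a b : ℝ≥0) (p : unitInterval) :
    (cubeMeasure (Edge d) p).map (weights a b) = bernoulliFPP d a b p := by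
  have h := Measure.infinitePi_map_pi (ι := Edge d) (X := fun _ => Bool) (Y := fun _ => ℝ≥0)
    (fun _ => bernoulliMeasure true false p) (f := fun _ c => if c then b else a)
    (fun _ => measurable_of_finite _)
  simp only [map_bernoulliMeasure] at h
  exact h

lemma sqrt_sqrt_mul_sqrt_log_div_le {N : ℝ} (hN : 2 ≤ N) :
    √(√N) * √(Real.log N / N) ≤ 2 := by
  have hN0 : 0 < N := by linarith
  have hlog : Real.log N ≤ 2 * √N := by
    have h1 := Real.log_sqrt hN0.le
    have h2 := Real.log_le_self (Real.sqrt_nonneg N)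
    linarith
  rw [← Real.sqrt_mul (Real.sqrt_nonneg N)]
  refine Real.sqrt_le_iff.2 ⟨by norm_num, ?_⟩
  rw [← mul_div_assoc, div_le_iff₀ hN0]
  have h3 := mul_le_mul_of_nonneg_left hlog (Real.sqrt_nonneg N)
  have h4 := Real.mul_self_sqrt hN0.le
  nlinarith

lemma exists_scale {N : ℝ} (hN : 1 ≤ N) :
    ∃ m : ℕ, 0 < m ∧ √(√N) ≤ m ∧ (m : ℝ) ≤ 2 * √(√N) := by
  have h1 : 1 ≤ √(√N) := Real.one_le_sqrt.2 (Real.one_le_sqrt.2 hN)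
  refine ⟨⌊√(√N)⌋₊ + 1, Nat.succ_pos _, ?_, ?_⟩
  · push_cast; exact (Nat.lt_floor_add_one _).le
  · have := Nat.floor_le (Real.sqrt_nonneg (√N))
    push_cast; linarith

lemma exists_rate {B D : ℝ} (hB : 0 ≤ B) (hD : 0 ≤ D) :
    ∃ c : ℝ, 0 < c ∧ c * B ≤ 1 ∧ D * c ^ 2 ≤ 1 / 2 := by
  have h : 0 < 1 + B + 2 * D := by positivity
  have hi : (1 + B + 2 * D)⁻¹ ≤ 1 := inv_le_one_of_one_le₀ (by linarith)
  refine ⟨(1 + B + 2 * D)⁻¹, by positivity, ?_, ?_⟩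
  · rw [inv_mul_le_iff₀ h]; linarith
  · calc D * (1 + B + 2 * D)⁻¹ ^ 2 = D * (1 + B + 2 * D)⁻¹ * (1 + B + 2 * D)⁻¹ := by ring
      _ ≤ D * (1 + B + 2 * D)⁻¹ * 1 := by gcongr
      _ ≤ 1 / 2 := by rw [mul_one, ← div_eq_mul_inv, div_le_iff₀ h]; linarith

/-- Concentration is not affected by a bounded perturbation. -/
lemma measureReal_lt_abs_sub_integral_le {Ω : Type*} [MeasurableSpace Ω] (μ : Measure Ω)
    [IsProbabilityMeasure μ] {f F : Ω → ℝ} (hf : Integrable f μ) (hF : Integrable F μ) {R : ℝ}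
    (h : ∀ x, |F x - f x| ≤ R) (u : ℝ) :
    μ.real {x | u < |f x - ∫ y, f y ∂μ|} ≤ μ.real {x | u - 2 * R < |F x - ∫ y, F y ∂μ|} := by
  refine measureReal_mono fun x hx => ?_
  have hx' : u < |f x - ∫ y, f y ∂μ| := hx
  have h1 : |∫ y, F y ∂μ - ∫ y, f y ∂μ| ≤ R := by
    rw [← integral_sub hF hf]
    have := norm_integral_le_of_norm_le_const (μ := μ) (f := fun y => F y - f y)
      (Filter.Eventually.of_forall h)
    simpa using this
  have h2 : |f x - ∫ y, f y ∂μ| ≤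
      |F x - ∫ y, F y ∂μ| + |F x - f x| + |∫ y, F y ∂μ - ∫ y, f y ∂μ| := by
    have e : f x - ∫ y, f y ∂μ = (F x - ∫ y, F y ∂μ) - (F x - f x) +
        (∫ y, F y ∂μ - ∫ y, f y ∂μ) := by ring
    rw [e]
    exact (abs_add_le _ _).trans (add_le_add_left (abs_sub _ _) _)
  have h3 := h x
  change u - 2 * R < |F x - ∫ y, F y ∂μ|
  linarith

theorem cubeTime_concentration (hd : 2 ≤ d) (ha : 0 < a) (hab : a ≤ b) {p : unitInterval}
    (hp1 : (p : ℝ) < 1) :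
    ∃ C₁ C₂ : ℝ, 0 < C₁ ∧ 0 < C₂ ∧ ∀ v : Fin d → ℤ, 2 ≤ l1Norm v → ∀ t : ℝ,
      (cubeMeasure (Edge d) p).real {x | t * √((l1Norm v : ℝ) / Real.log (l1Norm v)) <
        |cubeTime a b 0 v x - ∫ y, cubeTime a b 0 v y ∂(cubeMeasure (Edge d) p)|} ≤
        C₁ * Real.exp (-C₂ * t) := by
  have hq : 0 < 1 - (p : ℝ) := sub_pos.2 hp1
  have ha' : (0 : ℝ) < a := ha
  have hb' : (0 : ℝ) < b := ha'.trans_le hab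
  set C₀ : ℝ := b ^ 2 / a * (1 + d) / (1 - p) with hC₀
  have hC₀0 : 0 < C₀ := by positivity
  set H : ℝ := 2 * b / (1 - p) + √(b * C₀) / (1 - p) ^ 2 with hH
  have hH0 : 0 < H := by positivity
  set D : ℝ := 8 * (b ^ 2 / a * H) with hD
  have hD0 : 0 < D := by positivity
  obtain ⟨c, hc0, hcb, hcD⟩ := exists_rate hb'.le hD0.le
  refine ⟨2 * Real.exp 2 * Real.exp (16 * c * b * d), c, by positivity, hc0, fun v hv t => ?_⟩
  set N : ℝ := (l1Norm v : ℝ) with hN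
  have hN2 : 2 ≤ N := by rw [hN]; exact_mod_cast hv
  have hN0 : 0 < N := by linarith
  set L := Real.log N with hL
  have hL0 : 0 < L := Real.log_pos (by linarith)
  have hLN : L ≤ N := Real.log_le_self hN0.le
  obtain ⟨m, hm0, hm1, hm2⟩ := exists_scale (by linarith : 1 ≤ N)
  set A := √(√N) with hA
  have hA0 : 0 < A := by positivity
  have hlogr : Real.log (√A) = L / 8 := by
    rw [hA, Real.log_sqrt (by positivity), Real.log_sqrt (by positivity),
      Real.log_sqrt (by positivity), hL]
    ring
  obtain ⟨s, hs⟩ := exists_dependsOn_avgTime ha hab m v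
  obtain ⟨s', hs'⟩ := exists_dependsOn_cubeTime (d := d) ha hab 0 v
  set θ := c * √(L / N) with hθ
  have hθ0 : 0 ≤ θ := by positivity
  have hsq : √(L / N) ≤ 1 := Real.sqrt_le_one.2 ((div_le_one hN0).2 hLN)
  have hm0' : (0 : ℝ) < m := by exact_mod_cast hm0
  have hrK : √A * √(b * (C₀ / m)) ≤ √(b * C₀) := by
    rw [← Real.sqrt_mul hA0.le]
    refine Real.sqrt_le_sqrt ?_
    calc A * (b * (C₀ / m)) = b * C₀ * (A / m) := by ring
      _ ≤ b * C₀ * 1 := by gcongr; exact (div_le_one hm0').2 hm1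
      _ = _ := mul_one _
  have hkey : b ^ 2 / a * N * (2 * b / (1 - p) + √A * √(b * (C₀ / m)) / (1 - p) ^ 2) ≤
      D * N / L * (1 + Real.log (√A)) := by
    rw [hlogr]
    calc b ^ 2 / a * N * (2 * b / (1 - p) + √A * √(b * (C₀ / m)) / (1 - p) ^ 2)
        ≤ b ^ 2 / a * N * H := by rw [hH]; gcongr
      _ = D * N / L * (L / 8) := by rw [hD]; field_simp
      _ ≤ D * N / L * (1 + L / 8) := by gcongr; linarith
  have hθb : θ * b ≤ 1 := by
    calc θ * b ≤ c * 1 * b := by rw [hθ]; gcongr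
      _ ≤ 1 := by rw [mul_one]; exact hcb
  have hθD : D * N / L * θ ^ 2 ≤ 1 / 2 := by
    have h1 : √(L / N) ^ 2 = L / N := Real.sq_sqrt (by positivity)
    have h2 : D * N / L * θ ^ 2 = D * c ^ 2 := by
      rw [hθ, mul_pow, h1]; field_simp
    rw [h2]
    exact hcD
  have main := cube_concentration (F := avgTime a b m v) (K := b) (S := b ^ 2 / a * N)
    (δ := C₀ / m) hp1 hs (by positivity) hb'.le
    (discDeriv_avgTime_nonneg hab m v) (discDeriv_avgTime_le ha hab hm0 v)
    (fun y => sum_discDeriv_avgTime_le ha hab hm0 v y s)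
    (fun e _ => integral_discDeriv_avgTime_le hd ha hab hp1 hm0 v e)
    (r := √A) (k := D * N / L) (by positivity) (by rw [hlogr]; positivity) (by positivity) hkey
    hθ0 hθb hθD (t * √(N / L) - 2 * (2 * b * (d * m)))
  have comp := measureReal_lt_abs_sub_integral_le (cubeMeasure (Edge d) p)
    (integrable_of_dependsOn p hs') (integrable_of_dependsOn p hs)
    (abs_avgTime_sub_le hab hm0 v) (t * √(N / L))
  refine (comp.trans main).trans ?_
  rw [mul_assoc (2 * Real.exp 2), ← Real.exp_add]
  gcongr
  have h1 : √(L / N) * √(N / L) = 1 := by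
    rw [← Real.sqrt_mul (by positivity), div_mul_div_cancel₀ hN0.ne', div_self hL0.ne',
      Real.sqrt_one]
  have h2 : √(L / N) * m ≤ 4 := by
    have := sqrt_sqrt_mul_sqrt_log_div_le hN2
    have h3 := mul_le_mul_of_nonneg_left hm2 (Real.sqrt_nonneg (L / N))
    linarith
  have h3 : θ * (t * √(N / L)) = c * t := by
    rw [hθ]
    calc _ = c * t * (√(L / N) * √(N / L)) := by ring
      _ = _ := by rw [h1, mul_one]
  have h4 : θ * (2 * (2 * b * (d * m))) ≤ 16 * c * b * d := by
    rw [hθ]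
    calc _ = 4 * c * b * d * (√(L / N) * m) := by ring
      _ ≤ 4 * c * b * d * 4 := by gcongr
      _ = _ := by ring
  rw [mul_sub, h3]
  linarith

lemma integrable_passageTime (ha : 0 < a) (hab : a ≤ b) (p : unitInterval) (u v : Fin d → ℤ) :
    Integrable (fun x => passageTime x u v) (bernoulliFPP d a b p) := by
  rw [← map_weights_cubeMeasure,
    integrable_map_measure (measurable_passageTime u v).aestronglyMeasurable
      (measurable_weights a b).aemeasurable]
  obtain ⟨s, hs⟩ := exists_dependsOn_cubeTime (d := d) ha hab u v
  exact integrable_of_dependsOn p hs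

lemma measureReal_passageTime (p : unitInterval) (u v : Fin d → ℤ) (c : ℝ) :
    (bernoulliFPP d a b p).real {x | c <
        |passageTime x u v - ∫ y, passageTime y u v ∂(bernoulliFPP d a b p)|} =
      (cubeMeasure (Edge d) p).real {x | c <
        |cubeTime a b u v x - ∫ y, cubeTime a b u v y ∂(cubeMeasure (Edge d) p)|} := by
  have hm := measurable_passageTime u v
  rw [← map_weights_cubeMeasure, integral_map (measurable_weights a b).aemeasurable
    hm.aestronglyMeasurable, map_measureReal_apply (measurable_weights a b)]
  · rfl
  · exact measurableSet_lt measurable_const (hm.sub_const _).norm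

lemma measureReal_cubeMeasure_one {f : (Edge d → Bool) → ℝ} (hf : Measurable f) {c : ℝ}
    (hc : 0 ≤ c) :
    (cubeMeasure (Edge d) 1).real {x | c < |f x - ∫ y, f y ∂(cubeMeasure (Edge d) 1)|} = 0 := by
  have h : cubeMeasure (Edge d) 1 = Measure.dirac fun _ => true := by
    simp [cubeMeasure]
  have hs : MeasurableSet {x | c < |f x - f fun _ => true|} :=
    measurableSet_lt measurable_const (hf.sub_const _).norm
  rw [h, integral_dirac' _ _ hf.stronglyMeasurable, measureReal_def, Measure.dirac_apply' _ hs]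
  simp [hc]

end Main

end FPP

theorem mainTheorem5 (d : ℕ) (hd : 2 ≤ d) (a b : ℝ≥0) (ha : 0 < a) (hab : a < b)
    (p : unitInterval) :
    ∃ C₁ C₂ : ℝ, 0 < C₁ ∧ 0 < C₂ ∧
      ∀ v : Fin d → ℤ, 2 ≤ FPP.l1Norm v →
        Integrable (fun x => FPP.passageTime x 0 v) (FPP.bernoulliFPP d a b p) ∧
        ∀ t : ℝ, 0 < t →
          (FPP.bernoulliFPP d a b p).real
            {x | t * √((FPP.l1Norm v : ℝ) / Real.log (FPP.l1Norm v)) <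
              |FPP.passageTime x 0 v -
                ∫ y, FPP.passageTime y 0 v ∂(FPP.bernoulliFPP d a b p)|}
            ≤ C₁ * Real.exp (-C₂ * t) := by
  rcases p.2.2.lt_or_eq with hp | hp
  · obtain ⟨C₁, C₂, h₁, h₂, h⟩ := FPP.cubeTime_concentration hd ha hab.le hp
    refine ⟨C₁, C₂, h₁, h₂, fun v hv =>
      ⟨FPP.integrable_passageTime ha hab.le p 0 v, fun t _ => ?_⟩⟩
    rw [FPP.measureReal_passageTime]
    exact h v hv t
  · obtain rfl : p = 1 := Subtype.ext hp
    refine ⟨1, 1, one_pos, one_pos, fun v _ =>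
      ⟨FPP.integrable_passageTime ha hab.le 1 0 v, fun t ht => ?_⟩⟩
    obtain ⟨s, hs⟩ := FPP.exists_dependsOn_cubeTime (d := d) ha hab.le 0 v
    rw [FPP.measureReal_passageTime, FPP.measureReal_cubeMeasure_one
      (FPP.measurable_of_dependsOn hs) (by positivity)]
    positivity
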